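/- Let $n\ge 4$, let $\mathbb S^{n-1}$ be the unit sphere of $\mathbb R^n$ with surface measure $\sigma$ and surface gradient $\nabla$, fix a point $\Phi\in\mathbb S^{n-1}$, and let $d(x)=\arccos(x\cdot\Phi)$ be the geodesic distance from $\Phi$. For $1<p<n-1$ let $W^{1,p}(\mathbb S^{n-1})$ be the space of real functions in $L^p(\mathbb S^{n-1})$ whose weak surface gradient exists and lies in $L^p$, let $H^1=W^{1,2}$, and put $$\alpha=\frac{n-p-1}{p},\qquad S_p(u)=\int_{\mathbb S^{n-1}}\frac{|u|^p}{\sin^p d}\,d\sigma,\qquad \widetilde S_p(u)=\int_{\mathbb S^{n-1}}\frac{|u|^p}{\sin^{p-2} d}\,d\sigma,\qquad F_p(u)=\int_{\mathbb S^{n-1}}|\nabla u|^p\,d\sigma .$$ (a) For every $1<p<n-1$ the inequality $\alpha^pS_p(u)\le F_p(u)+\alpha^{p-1}\widetilde S_p(u)$ is in general false on $W^{1,p}(\mathbb S^{n-1})$: there is $u\in W^{1,p}(\mathbb S^{n-1})$, with $S_p(u)$ and $\widetilde S_p(u)$ finite, such that $$\alpha^pS_p(u)>F_p(u)+\alpha^{p-1}\widetilde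 S_p(u).$$ (b) In particular, if $n>4$, there is $u\in H^1(\mathbb S^{n-1})$, with $\int_{\mathbb S^{n-1}}u^2/\sin^2 d\,d\sigma$ finite, such that $$\Big(\frac{n-3}{2}\Big)^2\int_{\mathbb S^{n-1}}\frac{u^2}{\sin^2 d}\,d\sigma>\int_{\mathbb S^{n-1}}|\nabla u|^2\,d\sigma+\frac{n-3}{2}\int_{\mathbb S^{n-1}}u^2\,d\sigma .$$ (c) If $1<p<n-2$, an explicit choice in (a) is $$w_\varepsilon=\Big(\frac{1+\cos d}{\sin d}\Big)^{\frac{n-p-1-2\varepsilon}{p}}:$$ there is $0<\varepsilon_0<(n-p-1)/2$ such that for all $0<\varepsilon<\varepsilon_0$ one has $w_\varepsilon\in W^{1,p}(\mathbb S^{n-1})$, the integrals $S_p(w_\varepsilon)$ and $\widetilde S_p(w_\varepsilon)$ are finite, and $\alpha^pS_p(w_\varepsilon)>F_p(w_\varepsilon)+\alpha^{p-1}\widetilde S_p(w_\varepsilon)$. -/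

import Mathlib

open MeasureTheory
open scoped ContDiff RealInnerProductSpace

noncomputable section

namespace SphereHardy

/-- The unit sphere `𝕊^{n-1}` of `ℝⁿ`. -/
abbrev Sph (n : ℕ) : Type := Metric.sphere (0 : EuclideanSpace ℝ (Fin n)) 1

/-- The surface measure `σ_{n-1}` on `𝕊^{n-1}` (total mass: the area of the unit sphere). -/
def surf (n : ℕ) : Measure (Sph n) :=
  (volume : Measure (EuclideanSpace ℝ (Fin n))).toSphere

/-- The geodesic distance `arccos (x · Φ)` on `𝕊^{n-1}`. -/
def geoDist {n : ℕ} (Φ x : Sph n) : ℝ :=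
  Real.arccos ⟪(x : EuclideanSpace ℝ (Fin n)), (Φ : EuclideanSpace ℝ (Fin n))⟫

/-- The surface divergence at a point `x` of the unit sphere of a vector field `V`: the trace of
the derivative of `V` over the tangent space `x^⊥`, that is, the full trace minus the contribution
of the unit normal `x`. It only depends on the restriction of `V` to the sphere. -/
def surfDiv {n : ℕ} (V : EuclideanSpace ℝ (Fin n) → EuclideanSpace ℝ (Fin n))
    (x : EuclideanSpace ℝ (Fin n)) : ℝ :=
  (∑ i : Fin n, ⟪fderiv ℝ V x (EuclideanSpace.single i 1), EuclideanSpace.single i 1⟫)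
    - ⟪fderiv ℝ V x x, x⟫

/-- `Ψ` is a weak surface gradient of `u` on `𝕊^{n-1}`: both are integrable, `Ψ` is tangential,
and `∫ Ψ · V dσ = - ∫ u div V dσ` for every smooth tangential vector field `V` on the sphere.
(Every smooth tangential field on the sphere is the restriction of a smooth field on `ℝⁿ`;
the latter is the form in which test fields are given here.) -/
structure IsWeakGradient {n : ℕ} (u : Sph n → ℝ) (Ψ : Sph n → EuclideanSpace ℝ (Fin n)) :
    Prop where
  integrable_fun : Integrable u (surf n)
  integrable_grad : Integrable Ψ (surf n)
  tangential : ∀ x : Sph n, ⟪Ψ x, (x : EuclideanSpace ℝ (Fin n))⟫ = 0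
  integral_eq : ∀ V : EuclideanSpace ℝ (Fin n) → EuclideanSpace ℝ (Fin n), ContDiff ℝ ∞ V →
    (∀ x : Sph n, ⟪V x, (x : EuclideanSpace ℝ (Fin n))⟫ = 0) →
    ∫ x : Sph n, ⟪Ψ x, V x⟫ ∂(surf n) = - ∫ x : Sph n, u x * surfDiv V x ∂(surf n)

/-- `u ∈ W^{1,p}(𝕊^{n-1})` with weak surface gradient `Ψ`: `u ∈ L^p` and `|Ψ| ∈ L^p`.
The field `Ψ` is determined by `u` up to a null set. -/
def MemW1pWithGradient {n : ℕ} (p : ℝ) (u : Sph n → ℝ)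
    (Ψ : Sph n → EuclideanSpace ℝ (Fin n)) : Prop :=
  IsWeakGradient u Ψ ∧ MemLp u (ENNReal.ofReal p) (surf n) ∧ MemLp Ψ (ENNReal.ofReal p) (surf n)

/-- The integrand `|u|^p / sin^q d`, where `d` is the distance from `Φ`. -/
def weighted {n : ℕ} (Φ : Sph n) (p q : ℝ) (u : Sph n → ℝ) (x : Sph n) : ℝ :=
  |u x| ^ p / Real.sin (geoDist Φ x) ^ q

/-- `S_p(u) = ∫ |u|^p / sin^p d dσ`. -/
def S {n : ℕ} (Φ : Sph n) (p : ℝ) (u : Sph n → ℝ) : ℝ :=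
  ∫ x, weighted Φ p p u x ∂(surf n)

/-- `S̃_p(u) = ∫ |u|^p / sin^{p-2} d dσ`. -/
def STilde {n : ℕ} (Φ : Sph n) (p : ℝ) (u : Sph n → ℝ) : ℝ :=
  ∫ x, weighted Φ p (p - 2) u x ∂(surf n)

/-- `F_p(u) = ∫ |∇u|^p dσ`, as a function of the gradient field `Ψ = ∇u`. -/
def F {n : ℕ} (p : ℝ) (Ψ : Sph n → EuclideanSpace ℝ (Fin n)) : ℝ :=
  ∫ x, ‖Ψ x‖ ^ p ∂(surf n)

/-- The constant `α_{n,p} = (n - p - 1) / p`. -/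
def alpha (n : ℕ) (p : ℝ) : ℝ := ((n : ℝ) - p - 1) / p

/-- The functions `w_ε = ((1 + cos d) / sin d) ^ ((n - p - 1 - 2ε) / p)`. -/
def w {n : ℕ} (Φ : Sph n) (p ε : ℝ) (x : Sph n) : ℝ :=
  ((1 + Real.cos (geoDist Φ x)) / Real.sin (geoDist Φ x)) ^ (((n : ℝ) - p - 1 - 2 * ε) / p)

/-- `u` lies in `W^{1,p}(𝕊^{n-1})`, the integrals `S_p(u)`, `S̃_p(u)` converge, and
`α^p S_p(u) ≤ F_p(u) + α^{p-1} S̃_p(u)` fails for `u`. -/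
def IsCounterexample {n : ℕ} (Φ : Sph n) (p : ℝ) (u : Sph n → ℝ) : Prop :=
  ∃ Ψ : Sph n → EuclideanSpace ℝ (Fin n), MemW1pWithGradient p u Ψ ∧
    Integrable (weighted Φ p p u) (surf n) ∧ Integrable (weighted Φ p (p - 2) u) (surf n) ∧
    alpha n p ^ p * S Φ p u > F p Ψ + alpha n p ^ (p - 1) * STilde Φ p u

end SphereHardy

end

/-! Write `c = x · Φ = cos d`, so that `sin d = √(1 - c²)`. The inequality is tested on zonal
functions `P(c) (1 - c²)^(-k)` whose singularity at `Φ` is slightly weaker than the critical one.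
All integrals involved are of the form `∫ Q(c) (1 - c²)^(-k)`, and they are compared with each
other, never computed, by applying the divergence theorem to `P(c) (1 - c²)^(-k) ∇c`. Let `κ = n - 1
- 2k > 0` be the distance to the exponent at which `S_p` diverges.

For (a), take `u = (sin d)^(-γ)` with `γ = α - κ/p`. The choice `P(c) = c` gives `(1 + κ) S̃ = κ S`,
while convexity gives `α^p - γ^p ≥ κ γ^(p-1)`. Hence `(α^p - γ^p) S ≥ γ^(p-1) (1 + κ) S̃`, which in
the limit `κ → 0` merely balances the correction `α^(p-1) S̃`. Strictness comes from `|∇u|^p = γ^p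
|c|^p u^p / sin^p d` and `|c|^p ≤ 1 - (1 - c²)/2`, which leave a further `γ^p S̃ / 2`. Part (b) is
the case `p = 2`.

For (c), `(1 + cos d) / sin d = cot (d/2)`, so `|∇w_ε| = β w_ε / sin d` with `β = α - 2ε/p`, and `F
= β^p S` exactly. The profiles `(1 + c)^b` give `S̃ ≤ 2ε · 2/(n - p) · S`, against the gain `α^p -
β^p ≥ 2ε β^(p-1)`. For small `ε` the gain wins because `2 < n - p`.

The analysis rests on `integrable_one_sub_height_sq_rpow` (integrability up to the critical
exponent) and `integral_zonal_by_parts_of_bound` (integration by parts across the poles). -/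

noncomputable section

namespace SphereHardy

open Filter Topology

/-! ### The divergence theorem on the sphere -/

/-- Integration in polar coordinates of a product of a radial and an angular function. -/
theorem integral_radial_mul_angular {E : Type*} [NormedAddCommGroup E] [NormedSpace ℝ E]
    [FiniteDimensional ℝ E] [Nontrivial E] [MeasurableSpace E] [BorelSpace E] (μ : Measure E)
    [μ.IsAddHaarMeasure] (φ : ℝ → ℝ) (D : E → ℝ) :
    ∫ x, D (‖x‖⁻¹ • x) * φ ‖x‖ ∂μ =
      (∫ x : Metric.sphere (0 : E) 1, D x ∂μ.toSphere) *
        ∫ r : Set.Ioi (0 : ℝ), φ r ∂(Measure.volumeIoiPow (Module.finrank ℝ E - 1)) := by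
  have h1 : ∫ x, D (‖x‖⁻¹ • x) * φ ‖x‖ ∂μ
      = ∫ x : ({(0)}ᶜ : Set E), D (‖x.1‖⁻¹ • x.1) * φ ‖x.1‖ ∂(μ.comap (↑)) := by
    rw [integral_subtype_comap (measurableSet_singleton _).compl
      fun x ↦ D (‖x‖⁻¹ • x) * φ ‖x‖, restrict_compl_singleton]
  rw [h1, ← integral_prod_mul]
  have := μ.measurePreserving_homeomorphUnitSphereProd.integral_comp
        (Homeomorph.measurableEmbedding _)
        (fun z : Metric.sphere (0 : E) 1 × Set.Ioi (0 : ℝ) => D z.1 * φ z.2)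
  simpa using this

theorem integral_fderiv_apply_eq_zero {E : Type*} [NormedAddCommGroup E] [NormedSpace ℝ E]
    [FiniteDimensional ℝ E] [MeasurableSpace E] [BorelSpace E] (μ : Measure E)
    [μ.IsAddHaarMeasure] {f : E → ℝ} (hf : ContDiff ℝ 1 f) (hc : HasCompactSupport f) (v : E) :
    ∫ x, fderiv ℝ f x v ∂μ = 0 := by
  have h := integral_mul_fderiv_eq_neg_fderiv_mul_of_integrable (μ := μ) (f := fun _ : E => (1 : ℝ))
    (g := f) (v := v) (by simp) ?_ ?_ (fun _ _ => by fun_prop)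
    (fun x _ => hf.differentiable one_ne_zero x)
  · simpa using h
  · simp only [one_mul]
    refine Continuous.integrable_of_hasCompactSupport ?_ (hc.fderiv_apply ℝ v)
    exact (hf.continuous_fderiv one_ne_zero).clm_apply continuous_const
  · simpa using hf.continuous.integrable_of_hasCompactSupport hc

variable {n : ℕ}

theorem sum_inner_single_eq (A : EuclideanSpace ℝ (Fin n) →L[ℝ] EuclideanSpace ℝ (Fin n))
    (y : EuclideanSpace ℝ (Fin n)) :
    ∑ i : Fin n, y i * (A y) i = ⟪A y, y⟫ := by
  simp [PiLp.inner_apply]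

/-- A smooth radial cutoff, `1` near `1` and `0` outside `[1/2, 3/2]`. -/
def annulusBump : ContDiffBump (1 : ℝ) := ⟨1 / 4, 1 / 2, by norm_num, by norm_num⟩

theorem annulusBump_eq_zero {r : ℝ} (hr : r ≤ 1 / 2) : annulusBump r = 0 := by
  apply annulusBump.zero_of_le_dist
  rw [Real.dist_eq, abs_sub_comm]
  exact le_trans (by norm_num [annulusBump]; linarith) (le_abs_self _)

theorem annulusBump_eq_zero_of_two_le {r : ℝ} (hr : 2 ≤ r) : annulusBump r = 0 := by
  apply annulusBump.zero_of_le_dist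
  rw [Real.dist_eq]
  exact le_trans (by norm_num [annulusBump]; linarith) (le_abs_self _)

theorem annulusBump_eventually_eq_zero {E : Type*} [NormedAddCommGroup E] :
    ∀ᶠ x : E in nhds 0, annulusBump (‖x‖ ^ 2) = 0 := by
  have : ∀ᶠ x : E in nhds 0, ‖x‖ ^ 2 < 1 / 2 :=
    (continuous_norm.pow 2).continuousAt.eventually_lt continuousAt_const (by simp)
  exact this.mono fun x hx => annulusBump_eq_zero hx.le

theorem hasCompactSupport_annulusBump_smul {E F : Type*} [NormedAddCommGroup E]
    [ProperSpace E] [NormedAddCommGroup F] [NormedSpace ℝ F] (g : E → F) :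
    HasCompactSupport fun x : E => annulusBump (‖x‖ ^ 2) • g x := by
  refine HasCompactSupport.intro (isCompact_closedBall (0 : E) 2) fun x hx => ?_
  have : 2 < ‖x‖ := by simpa using hx
  rw [annulusBump_eq_zero_of_two_le (by nlinarith), zero_smul]

/-- With angular factor `1`, polar coordinates turn this integral into that of a continuous,
nonnegative, compactly supported function on `E` that is positive on the unit sphere. The weight
`r⁻¹` is the one produced by differentiating `x ↦ x / ‖x‖`. -/
theorem integral_radial_ne_zero {E : Type*} [NormedAddCommGroup E] [InnerProductSpace ℝ E]
    [FiniteDimensional ℝ E] [Nontrivial E] :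
    ∫ r : Set.Ioi (0 : ℝ), annulusBump ((r : ℝ) ^ 2) * (r : ℝ)⁻¹
      ∂(Measure.volumeIoiPow (Module.finrank ℝ E - 1)) ≠ 0 := by
  borelize E
  intro h0
  have h := integral_radial_mul_angular (Measure.addHaar : Measure E)
    (fun r => annulusBump (r ^ 2) * r⁻¹) (fun _ => 1)
  rw [h0, mul_zero] at h
  simp only [one_mul] at h
  have hc : Continuous fun x : E => annulusBump (‖x‖ ^ 2) * ‖x‖⁻¹ := by
    rw [continuous_iff_continuousAt]
    intro x
    by_cases hx : x = 0
    · subst hx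
      refine (continuousAt_const (y := (0 : ℝ))).congr ?_
      filter_upwards [annulusBump_eventually_eq_zero (E := E)] with x hx
      simp [hx]
    · have : ‖x‖ ≠ 0 := by simpa using hx
      refine ContinuousAt.mul ?_ (continuous_norm.continuousAt.inv₀ this)
      exact (annulusBump.continuous.comp (continuous_norm.pow 2)).continuousAt
  obtain ⟨x, hx⟩ := exists_norm_eq E (zero_le_one (α := ℝ))
  refine (hc.integral_pos_of_hasCompactSupport_nonneg_nonzero (μ := Measure.addHaar) ?_ ?_
    (x := x) ?_).ne' h
  · exact hasCompactSupport_annulusBump_smul fun x : E => ‖x‖⁻¹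
  · intro x
    have := annulusBump.nonneg' (‖x‖ ^ 2)
    show 0 ≤ annulusBump (‖x‖ ^ 2) * ‖x‖⁻¹
    positivity
  · have : annulusBump (1 : ℝ) = 1 := annulusBump.one_of_mem_closedBall (by simp [annulusBump])
    simp [hx, this]

theorem hasFDerivAt_normalize {E : Type*} [NormedAddCommGroup E] [InnerProductSpace ℝ E]
    {x : E} (hx : x ≠ 0) :
    HasFDerivAt (fun x : E => ‖x‖⁻¹ • x)
      (‖x‖⁻¹ • (ContinuousLinearMap.id ℝ E -
        (innerSL ℝ (‖x‖⁻¹ • x)).smulRight (‖x‖⁻¹ • x))) x := by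
  have hn : ‖x‖ ≠ 0 := by simpa using hx
  have h1 : HasFDerivAt (fun x : E => ‖x‖) (‖x‖⁻¹ • innerSL ℝ x) x := by
    have h2 := (hasStrictFDerivAt_norm_sq x).hasFDerivAt.sqrt (by simpa using hx)
    have h3 : (fun y : E => √(‖y‖ ^ 2)) = fun y => ‖y‖ := by
      ext y; exact Real.sqrt_sq (norm_nonneg y)
    rw [h3, Real.sqrt_sq (norm_nonneg x)] at h2
    convert h2 using 1
    ext v
    simp
    field_simp
  have h2 := ((hasDerivAt_inv hn).comp_hasFDerivAt x h1).smul (hasFDerivAt_id x)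
  refine h2.congr_fderiv ?_
  ext v
  simp only [add_apply, smul_apply,
    sub_apply, ContinuousLinearMap.smulRight_apply,
    ContinuousLinearMap.id_apply, innerSL_apply_apply, inner_smul_left, Function.comp, id]
  simp only [conj_trivial, smul_eq_mul, smul_smul, smul_sub]
  rw [sub_eq_add_neg, ← neg_smul]
  congr 2
  field_simp

/-- The divergence theorem on the sphere: the surface divergence of a tangential `C¹` field
has integral zero. -/
theorem integral_surfDiv_eq_zero (W : EuclideanSpace ℝ (Fin n) → EuclideanSpace ℝ (Fin n))
    (hW : ∀ x : Sph n, ContDiffAt ℝ 1 W x)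
    (ht : ∀ x : Sph n, ⟪W x, (x : EuclideanSpace ℝ (Fin n))⟫ = 0) :
    ∫ x : Sph n, surfDiv W x ∂(surf n) = 0 := by
  rcases isEmpty_or_nonempty (Sph n) with he | ⟨⟨x₀⟩⟩
  · exact integral_of_isEmpty
  have : Nontrivial (EuclideanSpace ℝ (Fin n)) :=
    ⟨⟨x₀, 0, ne_of_apply_ne Norm.norm (by simp)⟩⟩
  have hy : ∀ x : EuclideanSpace ℝ (Fin n), x ≠ 0 →
      ‖x‖⁻¹ • x ∈ Metric.sphere (0 : EuclideanSpace ℝ (Fin n)) 1 := fun x hx => by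
    have : ‖x‖ ≠ 0 := by simpa using hx
    simp [norm_smul, this]
  -- Degree-zero homogeneous extension of `W`, cut off near the origin and at infinity. Its
  -- Euclidean divergence has integral zero and splits as `surfDiv W` at `x / ‖x‖` times a radial
  -- factor.
  let X : EuclideanSpace ℝ (Fin n) → EuclideanSpace ℝ (Fin n) := fun x =>
    annulusBump (‖x‖ ^ 2) • W (‖x‖⁻¹ • x)
  have hXd : ContDiff ℝ 1 X := by
    rw [contDiff_iff_contDiffAt]
    intro x
    by_cases hx : x = 0
    · subst hx
      refine (contDiffAt_const (c := (0 : EuclideanSpace ℝ (Fin n)))).congr_of_eventuallyEq ?_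
      filter_upwards [annulusBump_eventually_eq_zero (E := EuclideanSpace ℝ (Fin n))] with x hx
      simp [X, hx]
    · have h1 : ContDiffAt ℝ 1 (fun z : EuclideanSpace ℝ (Fin n) => annulusBump (‖z‖ ^ 2)) x :=
        (annulusBump.contDiff.comp (contDiff_norm_sq ℝ)).contDiffAt
      have h2 : ContDiffAt ℝ 1 (fun z : EuclideanSpace ℝ (Fin n) => ‖z‖⁻¹ • z) x :=
        ((contDiffAt_norm ℝ hx).inv (norm_ne_zero_iff.2 hx)).smul contDiffAt_id
      exact h1.smul (ContDiffAt.comp x (hW ⟨_, hy x hx⟩) h2)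
  have hXc : HasCompactSupport X := hasCompactSupport_annulusBump_smul _
  have hint : ∀ i : Fin n, Integrable
      (fun x => fderiv ℝ (fun y => X y i) x (EuclideanSpace.single i 1)) ∧
      ∫ x, fderiv ℝ (fun y => X y i) x (EuclideanSpace.single i 1) = 0 := by
    intro i
    have hd : ContDiff ℝ 1 (fun y => X y i) := (contDiff_piLp_apply 2).comp hXd
    have hc : HasCompactSupport (fun y => X y i) :=
      hXc.comp_left (g := fun v : EuclideanSpace ℝ (Fin n) => v i) (by simp)
    refine ⟨?_, integral_fderiv_apply_eq_zero volume hd hc _⟩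
    exact Continuous.integrable_of_hasCompactSupport
      ((hd.continuous_fderiv one_ne_zero).clm_apply continuous_const) (hc.fderiv_apply ℝ _)
  have hsum : ∫ x, ∑ i, fderiv ℝ (fun y => X y i) x (EuclideanSpace.single i 1) = 0 := by
    rw [integral_finsetSum _ fun i _ => (hint i).1]
    exact Finset.sum_eq_zero fun i _ => (hint i).2
  have hpt : ∀ x : EuclideanSpace ℝ (Fin n), x ≠ 0 →
      ∑ i, fderiv ℝ (fun y => X y i) x (EuclideanSpace.single i 1) =
        surfDiv W (‖x‖⁻¹ • x) * (annulusBump (‖x‖ ^ 2) * ‖x‖⁻¹) := by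
    intro x hx
    set y := ‖x‖⁻¹ • x with hydef
    have hn : ‖x‖ ≠ 0 := norm_ne_zero_iff.2 hx
    have hxy : x = ‖x‖ • y := by simp [hydef, smul_smul, hn]
    have hWd := ((hW ⟨y, hy x hx⟩).differentiableAt one_ne_zero).hasFDerivAt
    have h1 := HasFDerivAt.comp x hWd (hasFDerivAt_normalize hx)
    have h2 : HasFDerivAt (fun z : EuclideanSpace ℝ (Fin n) => annulusBump (‖z‖ ^ 2))
        (deriv annulusBump (‖x‖ ^ 2) • (2 • innerSL ℝ x)) x :=
      HasDerivAt.comp_hasFDerivAt (h₂ := annulusBump) x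
        (((annulusBump.contDiff (n := 1)).differentiable one_ne_zero _).hasDerivAt)
        (hasStrictFDerivAt_norm_sq x).hasFDerivAt
    have h3 := h2.smul h1
    have h4 : ∀ i, fderiv ℝ (fun y => X y i) x (EuclideanSpace.single i 1) =
        (fderiv ℝ X x (EuclideanSpace.single i 1)) i := by
      intro i
      have := ((EuclideanSpace.proj (𝕜 := ℝ) i).hasFDerivAt (x := X x)).comp x
        (hXd.differentiable one_ne_zero x).hasFDerivAt
      exact congrArg (fun A => A (EuclideanSpace.single i 1)) (HasFDerivAt.fderiv this)
    have h5 := HasFDerivAt.fderiv (f := X) h3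
    simp only [h4, h5]
    simp only [surfDiv, EuclideanSpace.inner_single_right, ← hydef]
    have ht' : ⟪W y, y⟫ = 0 := ht ⟨y, hy x hx⟩
    have e1 := sum_inner_single_eq (fderiv ℝ W y) y
    -- The gradient of the cutoff is radial and `W` is tangential, so differentiating the cutoff
    -- contributes nothing.
    have e2 : ∑ i : Fin n, x i * (W y) i = 0 := by
      have : ∑ i : Fin n, x i * (W y) i = ‖x‖ * ⟪W y, y⟫ := by
        rw [PiLp.inner_apply, Finset.mul_sum]
        refine Finset.sum_congr rfl fun i _ => ?_
        conv_lhs => rw [hxy]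
        simp; ring
      rw [this, ht', mul_zero]
    simp only [add_apply, smul_apply,
      ContinuousLinearMap.comp_apply,
      sub_apply, ContinuousLinearMap.smulRight_apply,
      ContinuousLinearMap.id_apply, innerSL_apply_apply, PiLp.add_apply, PiLp.smul_apply,
      EuclideanSpace.inner_single_right, Function.comp, map_sub, map_smul, PiLp.sub_apply,
      ← hydef, smul_eq_mul, Finset.sum_add_distrib, conj_trivial, one_mul]
    rw [← e1]
    have e3 : ∑ i, deriv annulusBump (‖x‖ ^ 2) * (2 • x.ofLp i) * (W y) i = 0 := by
      have : ∑ i, deriv annulusBump (‖x‖ ^ 2) * (2 • x.ofLp i) * (W y) i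
        = deriv annulusBump (‖x‖ ^ 2) * 2 * ∑ i : Fin n, x i * (W y) i := by
        rw [Finset.mul_sum]
        refine Finset.sum_congr rfl fun i _ => ?_
        simp; ring
      rw [this, e2, mul_zero]
    rw [e3, add_zero, ← Finset.sum_sub_distrib, Finset.sum_mul]
    refine Finset.sum_congr rfl fun i _ => ?_
    ring
  have hpolar := integral_radial_mul_angular (volume : Measure (EuclideanSpace ℝ (Fin n)))
    (fun r => annulusBump (r ^ 2) * r⁻¹) (surfDiv W)
  rw [← integral_congr_ae (f := fun x =>
    ∑ i, fderiv ℝ (fun y => X y i) x (EuclideanSpace.single i 1)), hsum] at hpolar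
  · exact (mul_eq_zero.1 hpolar.symm).resolve_right (integral_radial_ne_zero
      (E := EuclideanSpace ℝ (Fin n)))
  · filter_upwards [compl_mem_ae_iff.2 (measure_singleton (0 : EuclideanSpace ℝ (Fin n)))] with x hx
    exact hpt x hx

/-! ### Zonal functions -/

/-- The height `x · Φ = cos d(x)` of a point of the sphere over the equator of `Φ`. -/
abbrev height (Φ x : Sph n) : ℝ :=
  ⟪(x : EuclideanSpace ℝ (Fin n)), (Φ : EuclideanSpace ℝ (Fin n))⟫

/-- The tangential projection of the constant field `Φ`: the surface gradient of the height. -/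
def heightGrad (Φ : Sph n) (x : EuclideanSpace ℝ (Fin n)) : EuclideanSpace ℝ (Fin n) :=
  (Φ : EuclideanSpace ℝ (Fin n)) - ⟪x, (Φ : EuclideanSpace ℝ (Fin n))⟫ • x

instance : IsFiniteMeasure (surf n) := by unfold surf; infer_instance

theorem inner_self_sph (x : Sph n) :
    ⟪(x : EuclideanSpace ℝ (Fin n)), (x : EuclideanSpace ℝ (Fin n))⟫ = 1 := by simp

theorem abs_height_le (Φ x : Sph n) : |height Φ x| ≤ 1 := by
  simpa using abs_real_inner_le_norm (x : EuclideanSpace ℝ (Fin n)) (Φ : EuclideanSpace ℝ (Fin n))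

theorem height_mem_Icc (Φ x : Sph n) : height Φ x ∈ Set.Icc (-1 : ℝ) 1 :=
  abs_le.1 (abs_height_le Φ x)

theorem continuous_height (Φ : Sph n) : Continuous (height Φ) := by unfold height; fun_prop

theorem cos_geoDist (Φ x : Sph n) : Real.cos (geoDist Φ x) = height Φ x :=
  Real.cos_arccos (height_mem_Icc Φ x).1 (height_mem_Icc Φ x).2

theorem sin_geoDist (Φ x : Sph n) : Real.sin (geoDist Φ x) = √(1 - height Φ x ^ 2) :=
  Real.sin_arccos _

theorem contDiff_heightGrad (Φ : Sph n) : ContDiff ℝ ∞ (heightGrad Φ) := by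
  exact contDiff_const.sub ((contDiff_id.inner ℝ contDiff_const).smul contDiff_id)

theorem inner_heightGrad_self (Φ x : Sph n) :
    ⟪heightGrad Φ x, (x : EuclideanSpace ℝ (Fin n))⟫ = 0 := by
  rw [heightGrad, inner_sub_left, inner_smul_left, inner_self_sph, real_inner_comm]
  simp

theorem inner_pole_heightGrad (Φ x : Sph n) :
    ⟪(Φ : EuclideanSpace ℝ (Fin n)), heightGrad Φ x⟫ = 1 - height Φ x ^ 2 := by
  rw [heightGrad, inner_sub_right, inner_smul_right, inner_self_sph,
    real_inner_comm (x : EuclideanSpace ℝ (Fin n)) (Φ : EuclideanSpace ℝ (Fin n)), height, sq]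

theorem norm_heightGrad (Φ x : Sph n) : ‖heightGrad Φ x‖ = √(1 - height Φ x ^ 2) := by
  rw [norm_eq_sqrt_real_inner, ← inner_pole_heightGrad]
  congr 1
  nth_rw 1 [heightGrad]
  rw [inner_sub_left, inner_smul_left, real_inner_comm (heightGrad Φ x)
    (x : EuclideanSpace ℝ (Fin n)),
    inner_heightGrad_self, mul_zero, sub_zero]

/-- Pairing with the pole only sees the tangential part of the pole. -/
theorem inner_heightGrad_of_tangential (Φ x : Sph n) {v : EuclideanSpace ℝ (Fin n)}
    (hv : ⟪v, (x : EuclideanSpace ℝ (Fin n))⟫ = 0) :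
    ⟪heightGrad Φ x, v⟫ = ⟪(Φ : EuclideanSpace ℝ (Fin n)), v⟫ := by
  rw [heightGrad, inner_sub_left, inner_smul_left,
    real_inner_comm v (x : EuclideanSpace ℝ (Fin n)), hv, mul_zero,
    sub_zero]

/-- The height is a spherical harmonic of degree one, with Laplace eigenvalue `n - 1`. -/
theorem surfDiv_heightGrad (Φ x : Sph n) :
    surfDiv (heightGrad Φ) x = -((n : ℝ) - 1) * height Φ x := by
  obtain ⟨F, hF⟩ := Φ
  obtain ⟨y, hy⟩ := x
  have h1 : HasFDerivAt (fun z : EuclideanSpace ℝ (Fin n) => ⟪z, F⟫) (innerSL ℝ F) y := by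
    simpa [real_inner_comm] using (innerSL ℝ F).hasFDerivAt (x := y)
  have h2 : HasFDerivAt (heightGrad ⟨F, hF⟩) _ y := (h1.smul (hasFDerivAt_id y)).const_sub F
  have hyy : ⟪y, y⟫ = 1 := inner_self_sph ⟨y, hy⟩
  have hsum : ∑ i, F i * y i = ⟪y, F⟫ := by
    simp [PiLp.inner_apply]
  rw [surfDiv, h2.fderiv]
  simp only [neg_apply, add_apply, smul_apply, ContinuousLinearMap.smulRight_apply,
    innerSL_apply_apply, ContinuousLinearMap.id_apply, inner_neg_left, inner_add_left,
    inner_smul_left, id, conj_trivial, hyy, EuclideanSpace.inner_single_right]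
  simp [Finset.sum_neg_distrib, Finset.sum_add_distrib, hsum]
  rw [real_inner_comm y F]
  simp only [height]
  ring

/-- Product rule. In the subtracted normal term the part with `deriv g` carries the factor `⟪V x, x⟫
= 0`, so the pole itself may stand in place of its tangential projection. -/
theorem surfDiv_smul (Φ x : Sph n) {g : ℝ → ℝ} (hg : DifferentiableAt ℝ g (height Φ x))
    {V : EuclideanSpace ℝ (Fin n) → EuclideanSpace ℝ (Fin n)} (hV : DifferentiableAt ℝ V x)
    (ht : ⟪V x, (x : EuclideanSpace ℝ (Fin n))⟫ = 0) :
    surfDiv (fun z => g ⟪z, (Φ : EuclideanSpace ℝ (Fin n))⟫ • V z) x =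
      deriv g (height Φ x) * ⟪(Φ : EuclideanSpace ℝ (Fin n)), V x⟫ +
        g (height Φ x) * surfDiv V x := by
  obtain ⟨F, hF⟩ := Φ
  obtain ⟨y, hy⟩ := x
  have h1 : HasFDerivAt (fun z : EuclideanSpace ℝ (Fin n) => ⟪z, F⟫) (innerSL ℝ F) y := by
    simpa [real_inner_comm] using (innerSL ℝ F).hasFDerivAt (x := y)
  have h2 : HasFDerivAt (fun z => g ⟪z, F⟫ • V z) _ y :=
    (HasDerivAt.comp_hasFDerivAt (h₂ := g) y hg.hasDerivAt h1).smul hV.hasFDerivAt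
  have hsum : ∑ i, F i * V y i = ⟪F, V y⟫ := by
    simp [PiLp.inner_apply, mul_comm]
  rw [surfDiv, h2.fderiv, surfDiv]
  simp only [add_apply, smul_apply, ContinuousLinearMap.smulRight_apply,
    innerSL_apply_apply, inner_add_left, Function.comp,
    inner_smul_left, conj_trivial, EuclideanSpace.inner_single_right, Finset.sum_add_distrib,
    smul_eq_mul, ht, ← hsum, mul_zero, add_zero, one_mul,
    Finset.mul_sum, mul_sub]
  simp only [height]
  simp [mul_assoc]
  ring

theorem continuous_surfDiv {V : EuclideanSpace ℝ (Fin n) → EuclideanSpace ℝ (Fin n)}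
    (hV : ContDiff ℝ ∞ V) : Continuous fun x : Sph n => surfDiv V x := by
  have h := hV.continuous_fderiv (by simp)
  unfold surfDiv
  fun_prop

/-- Integration by parts on the sphere against a zonal function that is `C¹` up to the poles. -/
theorem integral_zonal_by_parts (Φ : Sph n) {g : ℝ → ℝ}
    (hg : ∀ t ∈ Set.Icc (-1 : ℝ) 1, ContDiffAt ℝ 1 g t)
    {V : EuclideanSpace ℝ (Fin n) → EuclideanSpace ℝ (Fin n)} (hV : ContDiff ℝ ∞ V)
    (ht : ∀ x : Sph n, ⟪V x, (x : EuclideanSpace ℝ (Fin n))⟫ = 0) :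
    ∫ x : Sph n, (deriv g (height Φ x) * ⟪(Φ : EuclideanSpace ℝ (Fin n)), V x⟫ +
        g (height Φ x) * surfDiv V x) ∂(surf n) = 0 := by
  rw [← integral_surfDiv_eq_zero (fun z => g ⟪z, (Φ : EuclideanSpace ℝ (Fin n))⟫ • V z)
    (fun x => ?_) fun x => ?_]
  · refine integral_congr_ae (ae_of_all _ fun x => ?_)
    exact (surfDiv_smul Φ x ((hg _ (height_mem_Icc Φ x)).differentiableAt one_ne_zero)
      (hV.differentiable (by simp) _) (ht x)).symm
  · refine ContDiffAt.smul (f := fun z => g ⟪z, (Φ : EuclideanSpace ℝ (Fin n))⟫) ?_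
      (hV.of_le (by exact_mod_cast le_top)).contDiffAt
    refine ContDiffAt.comp (g := g) (f := fun z => ⟪z, (Φ : EuclideanSpace ℝ (Fin n))⟫) _
      (hg _ (height_mem_Icc Φ x)) ?_
    exact contDiffAt_id.inner ℝ contDiffAt_const
  · rw [inner_smul_left, ht, mul_zero]

-- The cone over a point lies in a line, which is Lebesgue-null once `n ≥ 2`.
open scoped Pointwise in
theorem surf_singleton (hn : 2 ≤ n) (x : Sph n) : surf n {x} = 0 := by
  rw [surf, Measure.toSphere_apply' _ (measurableSet_singleton x)]
  have : volume (Set.Ioo (0 : ℝ) 1 • (Subtype.val '' ({x} : Set (Sph n))) :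
      Set (EuclideanSpace ℝ (Fin n))) = 0 := by
    refine measure_mono_null (t := (Submodule.span ℝ {(x : EuclideanSpace ℝ (Fin n))} :
      Set (EuclideanSpace ℝ (Fin n)))) ?_ (Measure.addHaar_submodule _ _ ?_)
    · rintro _ ⟨r, -, _, ⟨y, hy, rfl⟩, rfl⟩
      obtain rfl : y = x := hy
      exact Submodule.smul_mem _ _ (Submodule.mem_span_singleton_self _)
    · intro h
      have h1 := finrank_span_le_card (R := ℝ) ({(x : EuclideanSpace ℝ (Fin n))} : Set _)
      rw [h] at h1
      simp at h1
      omega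
  rw [this, mul_zero]

theorem ae_height_mem_Ioo (hn : 2 ≤ n) (Φ : Sph n) :
    ∀ᵐ x ∂(surf n), height Φ x ∈ Set.Ioo (-1 : ℝ) 1 := by
  have h1 : ∀ᵐ x ∂(surf n), x ≠ Φ := compl_mem_ae_iff.2 (surf_singleton hn Φ)
  have h2 : ∀ᵐ x ∂(surf n), x ≠ -Φ := compl_mem_ae_iff.2 (surf_singleton hn (-Φ))
  filter_upwards [h1, h2] with x hx1 hx2
  have h := height_mem_Icc Φ x
  refine ⟨lt_of_le_of_ne h.1 fun h' => hx2 ?_, lt_of_le_of_ne h.2 fun h' => hx1 ?_⟩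
  · have : ⟪(x : EuclideanSpace ℝ (Fin n)), -(Φ : EuclideanSpace ℝ (Fin n))⟫ = 1 := by
      rw [inner_neg_right]; simp only [height] at h'; linarith
    exact Subtype.ext ((inner_eq_one_iff_of_norm_eq_one (𝕜 := ℝ) (by simp) (by simp)).1 this)
  · exact Subtype.ext ((inner_eq_one_iff_of_norm_eq_one (𝕜 := ℝ) (by simp) (by simp)).1 h')

/-! ### Integrability of negative powers of `sin d` -/

theorem integrable_of_continuous_sph {f : Sph n → ℝ} (hf : Continuous f) :
    Integrable f (surf n) :=
  hf.integrable_of_hasCompactSupport (HasCompactSupport.of_compactSpace f)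

theorem one_sub_height_sq_nonneg (Φ x : Sph n) : 0 ≤ 1 - height Φ x ^ 2 := by
  have := (sq_le_one_iff_abs_le_one _).2 (abs_height_le Φ x)
  linarith

/-- The derivative of `t ↦ p t * (κ - t²) ^ (-k)` with `p` differentiable. -/
theorem hasDerivAt_mul_sub_sq_rpow {p : ℝ → ℝ} {p' κ t : ℝ} (k : ℝ) (hp : HasDerivAt p p' t)
    (ht : 0 < κ - t ^ 2) :
    HasDerivAt (fun t => p t * (κ - t ^ 2) ^ (-k))
      (p' * (κ - t ^ 2) ^ (-k) + 2 * k * t * p t * (κ - t ^ 2) ^ (-k - 1)) t := by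
  have h1 : HasDerivAt (fun t : ℝ => κ - t ^ 2) (-(2 * t)) t := by
    simpa using (hasDerivAt_pow 2 t).const_sub κ
  refine (hp.fun_mul (h1.rpow_const (p := -k) (Or.inl ht.ne'))).congr_deriv ?_
  ring

/-- Split at `y = η`: below it the factor `y` is small, above it `y ^ (-k)` is bounded. This lets
the less singular power be absorbed into the more singular one. -/
theorem rpow_one_sub_le {k η y : ℝ} (hk : 0 ≤ k) (hη : 0 < η) (hy : 0 < y) (hy2 : y ≤ 2) :
    y * y ^ (-k) ≤ η * y ^ (-k) + 2 * η ^ (-k) := by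
  have h1 := Real.rpow_pos_of_pos hy (-k)
  have h2 := Real.rpow_pos_of_pos hη (-k)
  rcases le_total y η with h | h
  · nlinarith
  · have h3 : y ^ (-k) ≤ η ^ (-k) := Real.rpow_le_rpow_of_nonpos hη h (by linarith)
    nlinarith

/-- The regularized field `c (1 + δ - c²)^(-k) ∇c` has divergence at most `K - (A/2) (1 + δ -
c²)^(-k)` with `A = n - 1 - 2k > 0`. Since the divergence integrates to zero, the bound follows,
with constants independent of `δ`. -/
theorem exists_integral_regularized_le (Φ : Sph n) {k : ℝ} (hk : 0 < k)
    (hkn : 2 * k < (n : ℝ) - 1) :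
    ∃ M : ℝ, ∀ δ : ℝ, 0 < δ → δ ≤ 1 →
      ∫ x, (1 + δ - height Φ x ^ 2) ^ (-k) ∂(surf n) ≤ M := by
  set N : ℝ := (n : ℝ) - 1 with hN
  set A := N - 2 * k with hA
  have hA0 : 0 < A := by linarith
  -- Chosen so that `(1 + A) η = A / 2`: absorption costs half of the good term `A y ^ (-k)`.
  set η := A / (2 * (1 + A)) with hη
  have hη0 : 0 < η := by positivity
  set K := (1 + A) * (2 * η ^ (-k)) with hK
  refine ⟨2 / A * (K * (surf n).real Set.univ), fun δ hδ hδ1 => ?_⟩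
  have hpos : ∀ t ∈ Set.Icc (-1 : ℝ) 1, 0 < 1 + δ - t ^ 2 := fun t ht => by
    nlinarith [ht.1, ht.2]
  let g : ℝ → ℝ := fun t => t * (1 + δ - t ^ 2) ^ (-k)
  have hg : ∀ t ∈ Set.Icc (-1 : ℝ) 1, ContDiffAt ℝ 1 g t := fun t ht =>
    contDiffAt_id.mul (ContDiffAt.rpow_const_of_ne (by fun_prop) (hpos t ht).ne')
  have hdg : ∀ t ∈ Set.Icc (-1 : ℝ) 1, deriv g t =
      (1 + δ - t ^ 2) ^ (-k) + 2 * k * t ^ 2 * (1 + δ - t ^ 2) ^ (-k - 1) := fun t ht => by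
    rw [(hasDerivAt_mul_sub_sq_rpow k (hasDerivAt_id' t) (hpos t ht)).deriv]
    ring
  have hcont : ∀ q : ℝ, Continuous fun x : Sph n => (1 + δ - height Φ x ^ 2) ^ q := fun q =>
    (continuous_const.sub ((continuous_height Φ).pow 2)).rpow_const
      fun x => Or.inl (hpos _ (height_mem_Icc Φ x)).ne'
  have hI := integral_zonal_by_parts Φ hg (contDiff_heightGrad Φ) (inner_heightGrad_self Φ)
  have hle : ∀ x : Sph n, deriv g (height Φ x) *
      ⟪(Φ : EuclideanSpace ℝ (Fin n)), heightGrad Φ x⟫ +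
        g (height Φ x) * surfDiv (heightGrad Φ) x ≤
      K - A / 2 * (1 + δ - height Φ x ^ 2) ^ (-k) := by
    intro x
    have hc := height_mem_Icc Φ x
    rw [inner_pole_heightGrad, surfDiv_heightGrad, hdg _ hc, ← hN]
    simp only [g]
    set c := height Φ x with hcdef
    have hy := hpos c hc
    set y := 1 + δ - c ^ 2 with hydef
    have hcy : c ^ 2 = 1 + δ - y := by rw [hydef]; ring
    have hyk := Real.rpow_pos_of_pos hy (-k)
    have hy1 : y ^ (-k - 1) = y ^ (-k) / y := by rw [Real.rpow_sub_one hy.ne']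
    have h1 : (1 - c ^ 2) * (y ^ (-k) / y) ≤ y ^ (-k) := by
      rw [← mul_div_assoc, div_le_iff₀ hy]
      nlinarith
    have h2 := rpow_one_sub_le hk.le hη0 hy (by nlinarith [sq_nonneg c])
    have h3 : (1 + A) * (y * y ^ (-k)) ≤ A / 2 * y ^ (-k) + K := by
      calc _ ≤ (1 + A) * (η * y ^ (-k) + 2 * η ^ (-k)) := by gcongr
        _ = _ := by rw [hK, hη]; field_simp
    have h4 : 2 * k * c ^ 2 * ((1 - c ^ 2) * (y ^ (-k) / y)) ≤ 2 * k * c ^ 2 * y ^ (-k) := by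
      gcongr
    rw [hy1]
    have h5 : (1 - c ^ 2) * y ^ (-k) ≤ y * y ^ (-k) := by
      gcongr; linarith
    have h6 : A * c ^ 2 * y ^ (-k) ≥ A * (1 - y) * y ^ (-k) := by
      rw [hcy]; gcongr; linarith
    have h7 : N = A + 2 * k := by rw [hA]; ring
    rw [h7]
    nlinarith
  have hint : Integrable (fun x : Sph n => K - A / 2 * (1 + δ - height Φ x ^ 2) ^ (-k)) (surf n) :=
    integrable_of_continuous_sph (continuous_const.sub (continuous_const.mul (hcont _)))
  have hint2 : Integrable (fun x : Sph n => (1 + δ - height Φ x ^ 2) ^ (-k)) (surf n) :=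
    integrable_of_continuous_sph (hcont _)
  have h0 : 0 ≤ ∫ x : Sph n, (K - A / 2 * (1 + δ - height Φ x ^ 2) ^ (-k)) ∂(surf n) := by
    rw [← hI]
    refine integral_mono_ae ?_ hint (ae_of_all _ hle)
    refine integrable_of_continuous_sph (Continuous.add (Continuous.mul ?_ ?_) ?_)
    · have : (fun x : Sph n => deriv g (height Φ x)) = fun x : Sph n =>
          (1 + δ - height Φ x ^ 2) ^ (-k) +
            2 * k * height Φ x ^ 2 * (1 + δ - height Φ x ^ 2) ^ (-k - 1) :=
        funext fun x => hdg _ (height_mem_Icc Φ x)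
      rw [this]
      exact (hcont _).add ((continuous_const.mul ((continuous_height Φ).pow 2)).mul (hcont _))
    · exact continuous_const.inner ((contDiff_heightGrad Φ).continuous.comp continuous_subtype_val)
    · exact ((continuous_height Φ).mul (hcont _)).mul (continuous_surfDiv (contDiff_heightGrad Φ))
  have hc : ∫ _ : Sph n, K ∂(surf n) = (surf n).real Set.univ * K := by simp
  rw [integral_sub (integrable_const _) (hint2.const_mul _), hc,
    integral_const_mul (A / 2) fun x : Sph n => (1 + δ - height Φ x ^ 2) ^ (-k)] at h0
  rw [div_mul_eq_mul_div, le_div_iff₀ hA0]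
  linarith

/-- `(sin d) ^ (-2k)` is integrable on `𝕊^{n-1}` as soon as `2k < n - 1`. -/
theorem integrable_one_sub_height_sq_rpow (hn : 2 ≤ n) (Φ : Sph n) {k : ℝ}
    (hkn : 2 * k < (n : ℝ) - 1) :
    Integrable (fun x => (1 - height Φ x ^ 2) ^ (-k)) (surf n) := by
  rcases le_or_gt k 0 with hk | hk
  · refine integrable_of_continuous_sph ?_
    exact (continuous_const.sub ((continuous_height Φ).pow 2)).rpow_const
      fun x => Or.inr (by linarith)
  obtain ⟨M, hM⟩ := exists_integral_regularized_le Φ hk hkn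
  let δ : ℕ → ℝ := fun j => 1 / ((j : ℝ) + 1)
  have hδ0 : ∀ j, 0 < δ j := fun j => by positivity
  have hδ1 : ∀ j, δ j ≤ 1 := fun j => by
    simp only [δ]; rw [div_le_one (by positivity)]; simp
  have hcont : ∀ j, Continuous fun x : Sph n => (1 + δ j - height Φ x ^ 2) ^ (-k) := fun j =>
    (continuous_const.sub ((continuous_height Φ).pow 2)).rpow_const
      fun x => Or.inl (ne_of_gt (show 0 < 1 + δ j - height Φ x ^ 2 by
        linarith [one_sub_height_sq_nonneg Φ x, hδ0 j]))
  have hlim : ∀ᵐ x ∂(surf n), Tendsto (fun j => (1 + δ j - height Φ x ^ 2) ^ (-k)) atTop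
      (𝓝 ((1 - height Φ x ^ 2) ^ (-k))) := by
    filter_upwards [ae_height_mem_Ioo hn Φ] with x hx
    have h1 : Tendsto (fun j => 1 + δ j - height Φ x ^ 2) atTop (𝓝 (1 + 0 - height Φ x ^ 2)) :=
      (tendsto_one_div_add_atTop_nhds_zero_nat.const_add 1).sub_const _
    rw [add_zero] at h1
    exact h1.rpow_const (Or.inl (by nlinarith [hx.1, hx.2] : (0 : ℝ) < _).ne')
  have hmeas : ∀ j, AEStronglyMeasurable (fun x : Sph n => (1 + δ j - height Φ x ^ 2) ^ (-k))
      (surf n) := fun j => (hcont j).aestronglyMeasurable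
  refine ⟨aestronglyMeasurable_of_tendsto_ae _ hmeas hlim, ?_⟩
  -- Fatou's lemma carries the uniform bound over to `δ = 0`.
  refine lt_of_le_of_lt (b := liminf (fun j => ∫⁻ x : Sph n,
    ‖(1 + δ j - height Φ x ^ 2) ^ (-k)‖ₑ ∂(surf n)) atTop) ?_ ?_
  · exact lintegral_congr_ae (by filter_upwards [hlim] with x hx using hx.enorm.liminf_eq) ▸
      lintegral_liminf_le' fun j => (hmeas j).aemeasurable.enorm
  refine lt_of_le_of_lt (b := ENNReal.ofReal M) ?_ ENNReal.ofReal_lt_top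
  refine liminf_le_of_frequently_le' (Frequently.of_forall fun j => ?_)
  rw [← ofReal_integral_norm_eq_lintegral_enorm (integrable_of_continuous_sph (hcont j))]
  refine ENNReal.ofReal_le_ofReal ?_
  refine le_trans (le_of_eq (integral_congr_ae (ae_of_all _ fun x => ?_))) (hM _ (hδ0 j) (hδ1 j))
  exact Real.norm_of_nonneg (Real.rpow_nonneg
    (by linarith [one_sub_height_sq_nonneg Φ x, hδ0 j]) _)

/-! ### Integration by parts for zonal functions that are singular at the poles -/

/-- The dilated profiles `t ↦ g (r t)`, `r < 1`, are `C¹` up to the poles; dominated convergence as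
`r → 1` gives the claim. The derivative is required to be integrable only after multiplication by
`⟪Φ, V⟫`, which vanishes at the poles and compensates part of its singularity. -/
theorem integral_zonal_by_parts_of_bound (hn : 2 ≤ n) (Φ : Sph n) {g : ℝ → ℝ} {a b C : ℝ}
    (ha : 0 ≤ a) (hb : 0 ≤ b)
    (hg : ∀ t ∈ Set.Ioo (-1 : ℝ) 1, ContDiffAt ℝ 1 g t)
    (hg0 : ∀ t ∈ Set.Ioo (-1 : ℝ) 1, |g t| ≤ C * (1 - t ^ 2) ^ (-a))
    (hg1 : ∀ t ∈ Set.Ioo (-1 : ℝ) 1, |deriv g t| ≤ C * (1 - t ^ 2) ^ (-b))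
    (han : 2 * a < (n : ℝ) - 1)
    {V : EuclideanSpace ℝ (Fin n) → EuclideanSpace ℝ (Fin n)} (hV : ContDiff ℝ ∞ V)
    (ht : ∀ x : Sph n, ⟪V x, (x : EuclideanSpace ℝ (Fin n))⟫ = 0)
    (hbn : Integrable (fun x : Sph n => (1 - height Φ x ^ 2) ^ (-b) *
      |⟪(Φ : EuclideanSpace ℝ (Fin n)), V x⟫|) (surf n)) :
    Integrable (fun x : Sph n => g (height Φ x)) (surf n) ∧
    Integrable (fun x : Sph n => deriv g (height Φ x) *
      ⟪(Φ : EuclideanSpace ℝ (Fin n)), V x⟫) (surf n) ∧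
    ∫ x : Sph n, deriv g (height Φ x) * ⟪(Φ : EuclideanSpace ℝ (Fin n)), V x⟫ ∂(surf n) =
      - ∫ x : Sph n, g (height Φ x) * surfDiv V x ∂(surf n) := by
  have hC : 0 ≤ C := by
    simpa using (abs_nonneg _).trans (hg0 0 (by norm_num))
  -- The shift by `2` keeps `r 0` positive.
  let r : ℕ → ℝ := fun j => 1 - 1 / ((j : ℝ) + 2)
  have hr : ∀ j, 0 < r j ∧ r j < 1 := fun j => by
    have h1 : 1 / ((j : ℝ) + 2) < 1 := by
      rw [div_lt_one (by positivity)]; linarith [(Nat.cast_nonneg j : (0 : ℝ) ≤ j)]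
    have h2 : 0 < 1 / ((j : ℝ) + 2) := by positivity
    exact ⟨by simp only [r]; linarith, by simp only [r]; linarith⟩
  have hrlim : Tendsto r atTop (𝓝 1) := by
    have h : Tendsto (fun j : ℕ => 1 / ((j : ℝ) + 2)) atTop (𝓝 0) := by
      have := (tendsto_add_atTop_iff_nat 1).2
        (tendsto_one_div_add_atTop_nhds_zero_nat (𝕜 := ℝ))
      refine this.congr fun j => ?_
      push_cast; ring
    simpa [r] using h.const_sub 1
  have hrmem : ∀ j, ∀ t ∈ Set.Icc (-1 : ℝ) 1, r j * t ∈ Set.Ioo (-1 : ℝ) 1 := fun j t ht => by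
    obtain ⟨h1, h2⟩ := hr j
    constructor <;> nlinarith [ht.1, ht.2]
  -- Dilation moves points away from the poles, so the bounds at `t` dominate those at `r j * t` for
  -- every `j`.
  have hpow : ∀ q : ℝ, 0 ≤ q → ∀ j, ∀ t ∈ Set.Ioo (-1 : ℝ) 1,
      (1 - (r j * t) ^ 2) ^ (-q) ≤ (1 - t ^ 2) ^ (-q) := fun q hq j t ht => by
    refine Real.rpow_le_rpow_of_nonpos (by nlinarith [ht.1, ht.2]) ?_ (by linarith)
    have : (r j) ^ 2 ≤ 1 := by nlinarith [(hr j).1, (hr j).2]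
    nlinarith [sq_nonneg t]
  let G : ℕ → ℝ → ℝ := fun j t => g (r j * t)
  have hGd : ∀ j t, deriv (G j) t = r j * deriv g (r j * t) := fun j t => by
    simpa using deriv_comp_mul_left (r j) g t
  have hGc : ∀ j, ∀ t ∈ Set.Icc (-1 : ℝ) 1, ContDiffAt ℝ 1 (G j) t := fun j t ht =>
    ContDiffAt.comp t (hg _ (hrmem j t ht)) (by fun_prop)
  have hdc : ∀ t ∈ Set.Ioo (-1 : ℝ) 1, ContinuousAt (deriv g) t := fun t ht => by
    simpa only [fderiv_apply_one_eq_deriv] using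
      ((hg t ht).continuousAt_fderiv one_ne_zero).clm_apply (continuousAt_const (y := (1 : ℝ)))
  have hcont0 : ∀ j, Continuous fun x : Sph n => G j (height Φ x) := fun j => by
    rw [continuous_iff_continuousAt]
    intro x
    exact ContinuousAt.comp (f := height Φ) (hGc j _ (height_mem_Icc Φ x)).continuousAt
      (continuous_height Φ).continuousAt
  have hcont1 : ∀ j, Continuous fun x : Sph n => deriv (G j) (height Φ x) := fun j => by
    rw [continuous_iff_continuousAt]
    intro x
    simp only [hGd]
    refine continuousAt_const.mul ?_
    exact ContinuousAt.comp (f := fun x => r j * height Φ x)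
      (hdc _ (hrmem j _ (height_mem_Icc Φ x)))
      (continuous_const.mul (continuous_height Φ)).continuousAt
  have hcV : Continuous fun x : Sph n => ⟪(Φ : EuclideanSpace ℝ (Fin n)), V x⟫ :=
    continuous_const.inner (hV.continuous.comp continuous_subtype_val)
  have hcD := continuous_surfDiv hV
  obtain ⟨D, hD⟩ : ∃ D : ℝ, ∀ x : Sph n, |surfDiv V x| ≤ D := by
    obtain ⟨D, hD⟩ := isCompact_univ.exists_bound_of_continuousOn hcD.continuousOn
    exact ⟨D, fun x => hD x (Set.mem_univ x)⟩
  have hia := integrable_one_sub_height_sq_rpow hn Φ han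
  have hlim0 : ∀ᵐ x ∂(surf n), Tendsto (fun j => G j (height Φ x)) atTop
      (𝓝 (g (height Φ x))) := by
    filter_upwards [ae_height_mem_Ioo hn Φ] with x hx
    have h := hrlim.mul_const (height Φ x)
    rw [one_mul] at h
    exact (hg _ hx).continuousAt.tendsto.comp h
  have hlim1 : ∀ᵐ x ∂(surf n), Tendsto (fun j => deriv (G j) (height Φ x)) atTop
      (𝓝 (deriv g (height Φ x))) := by
    filter_upwards [ae_height_mem_Ioo hn Φ] with x hx
    have h := hrlim.mul_const (height Φ x)
    rw [one_mul] at h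
    have h2 := hrlim.mul ((hdc _ hx).tendsto.comp h)
    rw [one_mul] at h2
    exact h2.congr fun j => (hGd j _).symm
  have hb0 : ∀ j, ∀ᵐ x ∂(surf n), ‖G j (height Φ x)‖ ≤ C * (1 - height Φ x ^ 2) ^ (-a) := by
    intro j
    filter_upwards [ae_height_mem_Ioo hn Φ] with x hx
    exact (hg0 _ (hrmem j _ (height_mem_Icc Φ x))).trans
      (mul_le_mul_of_nonneg_left (hpow a ha j _ hx) hC)
  have hb1 : ∀ j, ∀ᵐ x ∂(surf n), |deriv (G j) (height Φ x)| ≤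
      C * (1 - height Φ x ^ 2) ^ (-b) := by
    intro j
    filter_upwards [ae_height_mem_Ioo hn Φ] with x hx
    rw [hGd, abs_mul, abs_of_pos (hr j).1]
    refine le_trans ?_ ((hg1 _ (hrmem j _ (height_mem_Icc Φ x))).trans
      (mul_le_mul_of_nonneg_left (hpow b hb j _ hx) hC))
    exact mul_le_of_le_one_left (abs_nonneg _) (hr j).2.le
  have hm0 : AEStronglyMeasurable (fun x : Sph n => g (height Φ x)) (surf n) :=
    aestronglyMeasurable_of_tendsto_ae _ (fun j => (hcont0 j).aestronglyMeasurable) hlim0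
  have hm1 : AEStronglyMeasurable (fun x : Sph n => deriv g (height Φ x)) (surf n) :=
    aestronglyMeasurable_of_tendsto_ae _ (fun j => (hcont1 j).aestronglyMeasurable) hlim1
  refine ⟨(hia.const_mul C).mono' hm0 ?_, (hbn.const_mul C).mono'
    (hm1.mul hcV.aestronglyMeasurable) ?_, ?_⟩
  · filter_upwards [ae_height_mem_Ioo hn Φ] with x hx using hg0 _ hx
  · filter_upwards [ae_height_mem_Ioo hn Φ] with x hx
    rw [norm_mul, ← mul_assoc]
    exact mul_le_mul_of_nonneg_right (hg1 _ hx) (abs_nonneg _)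
  have hL : Tendsto (fun j => ∫ x : Sph n, deriv (G j) (height Φ x) *
      ⟪(Φ : EuclideanSpace ℝ (Fin n)), V x⟫ ∂(surf n)) atTop (𝓝 (∫ x : Sph n,
      deriv g (height Φ x) * ⟪(Φ : EuclideanSpace ℝ (Fin n)), V x⟫ ∂(surf n))) := by
    refine tendsto_integral_of_dominated_convergence _
      (fun j => ((hcont1 j).mul hcV).aestronglyMeasurable) (hbn.const_mul C) (fun j => ?_) ?_
    · filter_upwards [hb1 j] with x hx
      rw [norm_mul, ← mul_assoc]
      exact mul_le_mul_of_nonneg_right hx (abs_nonneg _)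
    · filter_upwards [hlim1] with x hx using hx.mul_const _
  have hR : Tendsto (fun j => ∫ x : Sph n, G j (height Φ x) * surfDiv V x ∂(surf n)) atTop
      (𝓝 (∫ x : Sph n, g (height Φ x) * surfDiv V x ∂(surf n))) := by
    refine tendsto_integral_of_dominated_convergence _
      (fun j => ((hcont0 j).mul hcD).aestronglyMeasurable) ((hia.const_mul C).mul_const D)
      (fun j => ?_) ?_
    · filter_upwards [hb0 j] with x hx
      rw [norm_mul]
      exact mul_le_mul hx (hD x) (abs_nonneg _) ((norm_nonneg _).trans hx)
    · filter_upwards [hlim0] with x hx using hx.mul_const _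
  refine tendsto_nhds_unique hL (hR.neg.congr fun j => ?_)
  have h := integral_zonal_by_parts Φ (hGc j) hV ht
  have hi1 : Integrable (fun x : Sph n => deriv (G j) (height Φ x) *
      ⟪(Φ : EuclideanSpace ℝ (Fin n)), V x⟫) (surf n) :=
    integrable_of_continuous_sph ((hcont1 j).mul hcV)
  have hi2 : Integrable (fun x : Sph n => G j (height Φ x) * surfDiv V x) (surf n) :=
    integrable_of_continuous_sph ((hcont0 j).mul hcD)
  rw [integral_add hi1 hi2] at h
  linarith

/-! ### Zonal functions with a power singularity at the poles -/

/-- `P` is `C¹` on `(-1, 1)`, and both `P` and `(1 - t²) P'` are bounded by `B`. -/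
structure BoundedProfile (P : ℝ → ℝ) (B : ℝ) : Prop where
  contDiffAt : ∀ t ∈ Set.Ioo (-1 : ℝ) 1, ContDiffAt ℝ 1 P t
  bound : ∀ t ∈ Set.Ioo (-1 : ℝ) 1, |P t| ≤ B
  bound_deriv : ∀ t ∈ Set.Ioo (-1 : ℝ) 1, |deriv P t| * (1 - t ^ 2) ≤ B

theorem one_sub_sq_pos {t : ℝ} (ht : t ∈ Set.Ioo (-1 : ℝ) 1) : 0 < 1 - t ^ 2 := by
  nlinarith [ht.1, ht.2]

theorem boundedProfile_one : BoundedProfile (fun _ => 1) 1 where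
  contDiffAt _ _ := contDiffAt_const
  bound _ _ := by simp
  bound_deriv _ _ := by simp

theorem boundedProfile_id : BoundedProfile (fun t => t) 1 where
  contDiffAt _ _ := contDiffAt_id
  bound _ ht := abs_le.2 ⟨ht.1.le, ht.2.le⟩
  bound_deriv t _ := by simp [sq_nonneg]

theorem hasDerivAt_one_add_rpow {a t : ℝ} (ht : -1 < t) :
    HasDerivAt (fun t : ℝ => (1 + t) ^ a) (a * (1 + t) ^ (a - 1)) t := by
  have h : HasDerivAt (fun t : ℝ => 1 + t) 1 t := (hasDerivAt_id' t).const_add 1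
  refine (h.rpow_const (p := a) (Or.inl (by linarith))).congr_deriv ?_
  ring

theorem deriv_one_add_rpow_mul {a t : ℝ} (ht : -1 < t) :
    deriv (fun t : ℝ => (1 + t) ^ a) t * (1 - t ^ 2) = a * (1 + t) ^ a * (1 - t) := by
  have h : (1 : ℝ) + t ≠ 0 := by linarith
  rw [(hasDerivAt_one_add_rpow ht).deriv, Real.rpow_sub_one h]
  field_simp
  ring

/-- For `a < 1` the derivative blows up at `t = -1`, but the weight `1 - t²` absorbs this. The
suprema are controlled by `2 ^ a` and `2 a 2 ^ a`, both below the stated constant. -/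
theorem boundedProfile_one_add_rpow {a : ℝ} (ha : 0 ≤ a) :
    BoundedProfile (fun t => (1 + t) ^ a) (2 ^ a * (1 + 2 * a)) where
  contDiffAt t ht := ContDiffAt.rpow_const_of_ne (by fun_prop) (by linarith [ht.1])
  bound t ht := by
    have h0 : 0 ≤ 1 + t := by linarith [ht.1]
    have h1 : (1 + t) ^ a ≤ 2 ^ a := Real.rpow_le_rpow h0 (by linarith [ht.2]) ha
    rw [abs_of_nonneg (Real.rpow_nonneg h0 a)]
    have : (0 : ℝ) ≤ 2 ^ a := by positivity
    nlinarith
  bound_deriv t ht := by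
    have h0 : 0 ≤ 1 + t := by linarith [ht.1]
    have h1 : (1 + t) ^ a ≤ 2 ^ a := Real.rpow_le_rpow h0 (by linarith [ht.2]) ha
    have h2 := Real.rpow_nonneg h0 a
    rw [← abs_of_pos (one_sub_sq_pos ht), ← abs_mul, deriv_one_add_rpow_mul ht.1, abs_of_nonneg
      (mul_nonneg (by positivity) (by linarith [ht.2]))]
    have h3 : a * (1 + t) ^ a * (1 - t) ≤ a * 2 ^ a * 2 := by
      have := ht.1
      have := ht.2
      gcongr
      linarith
    have : (0 : ℝ) ≤ 2 ^ a := by positivity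
    nlinarith

namespace BoundedProfile

variable {P : ℝ → ℝ} {B : ℝ}

theorem contDiffAt_mul_rpow (h : BoundedProfile P B) (k : ℝ) {t : ℝ}
    (ht : t ∈ Set.Ioo (-1 : ℝ) 1) : ContDiffAt ℝ 1 (fun t => P t * (1 - t ^ 2) ^ (-k)) t :=
  (h.contDiffAt t ht).mul (ContDiffAt.rpow_const_of_ne (by fun_prop) (one_sub_sq_pos ht).ne')

theorem deriv_mul_rpow (h : BoundedProfile P B) (k : ℝ) {t : ℝ} (ht : t ∈ Set.Ioo (-1 : ℝ) 1) :
    deriv (fun t => P t * (1 - t ^ 2) ^ (-k)) t =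
      (deriv P t * (1 - t ^ 2) + 2 * k * t * P t) * (1 - t ^ 2) ^ (-k - 1) := by
  have hy := one_sub_sq_pos ht
  rw [(hasDerivAt_mul_sub_sq_rpow k
    ((h.contDiffAt t ht).differentiableAt one_ne_zero).hasDerivAt hy).deriv,
    Real.rpow_sub_one hy.ne']
  field_simp

/-- The constant is larger than needed here: it is the one required for the derivative, so that a
single `C` serves both bounds. -/
theorem abs_mul_rpow_le (h : BoundedProfile P B) {k : ℝ} (hk : 0 ≤ k) {t : ℝ}
    (ht : t ∈ Set.Ioo (-1 : ℝ) 1) :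
    |P t * (1 - t ^ 2) ^ (-k)| ≤ (1 + 2 * k) * B * (1 - t ^ 2) ^ (-k) := by
  have hB := h.bound t ht
  have hy := Real.rpow_pos_of_pos (one_sub_sq_pos ht) (-k)
  rw [abs_mul, abs_of_pos hy]
  refine mul_le_mul_of_nonneg_right ?_ hy.le
  nlinarith [abs_nonneg (P t)]

theorem abs_deriv_mul_rpow_le (h : BoundedProfile P B) {k : ℝ} (hk : 0 ≤ k) {t : ℝ}
    (ht : t ∈ Set.Ioo (-1 : ℝ) 1) :
    |deriv (fun t => P t * (1 - t ^ 2) ^ (-k)) t| ≤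
      (1 + 2 * k) * B * (1 - t ^ 2) ^ (-(k + 1)) := by
  have hB := h.bound t ht
  have hB1 := h.bound_deriv t ht
  have hy := Real.rpow_pos_of_pos (one_sub_sq_pos ht) (-k - 1)
  rw [h.deriv_mul_rpow k ht, abs_mul, abs_of_pos hy, neg_add']
  refine mul_le_mul_of_nonneg_right ?_ hy.le
  refine (abs_add_le _ _).trans ?_
  rw [abs_mul, abs_of_pos (one_sub_sq_pos ht), abs_mul, abs_mul,
    abs_of_nonneg (show 0 ≤ 2 * k by positivity)]
  have ht1 : |t| ≤ 1 := abs_le.2 ⟨ht.1.le, ht.2.le⟩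
  have : 2 * k * |t| * |P t| ≤ 2 * k * 1 * B := by gcongr
  linarith

theorem integrable_mul_rpow (h : BoundedProfile P B) (hn : 2 ≤ n) (Φ : Sph n) {k : ℝ}
    (hkn : 2 * k < (n : ℝ) - 1) :
    Integrable (fun x => P (height Φ x) * (1 - height Φ x ^ 2) ^ (-k)) (surf n) := by
  have hm : AEStronglyMeasurable (fun x => P (height Φ x)) (surf n) := by
    have hc : ContinuousOn P (Set.Ioo (-1 : ℝ) 1) := fun t ht =>
      (h.contDiffAt t ht).continuousAt.continuousWithinAt
    classical
    have h1 : Measurable ((Set.Ioo (-1 : ℝ) 1).piecewise P fun _ => 0) :=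
      hc.measurable_piecewise continuousOn_const measurableSet_Ioo
    refine ((h1.comp (continuous_height Φ).measurable).aestronglyMeasurable).congr ?_
    filter_upwards [ae_height_mem_Ioo hn Φ] with x hx
    exact Set.piecewise_eq_of_mem _ _ _ hx
  refine (integrable_one_sub_height_sq_rpow hn Φ hkn).bdd_mul (c := B) hm ?_
  filter_upwards [ae_height_mem_Ioo hn Φ] with x hx using h.bound _ hx

/-- The divergence theorem for the field `P(c) (1 - c²) ^ (-k) ∇c`, where `c` is the height. -/
theorem integral_eq_zero (h : BoundedProfile P B) (hn : 2 ≤ n) (Φ : Sph n) {k κ : ℝ}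
    (hk : 0 ≤ k) (hκ : 0 < κ) (hkκ : 2 * k + κ = (n : ℝ) - 1) :
    ∫ x : Sph n, (deriv P (height Φ x) * (1 - height Φ x ^ 2) -
      κ * height Φ x * P (height Φ x)) * (1 - height Φ x ^ 2) ^ (-k) ∂(surf n) = 0 := by
  have hkn : 2 * k < (n : ℝ) - 1 := by linarith
  -- For `V = ∇c` the pairing with the pole is `1 - c²`, which gains a full power and brings the
  -- exponent `k + 1` back to `k`.
  have hbn : Integrable (fun x : Sph n => (1 - height Φ x ^ 2) ^ (-(k + 1)) *
      |⟪(Φ : EuclideanSpace ℝ (Fin n)), heightGrad Φ x⟫|) (surf n) := by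
    refine (integrable_one_sub_height_sq_rpow hn Φ hkn).congr ?_
    filter_upwards [ae_height_mem_Ioo hn Φ] with x hx
    have hy := one_sub_sq_pos hx
    rw [inner_pole_heightGrad, abs_of_pos hy, neg_add', Real.rpow_sub_one hy.ne']
    field_simp
  obtain ⟨h0, h1, h2⟩ := integral_zonal_by_parts_of_bound hn Φ hk (by linarith)
    (fun t ht => h.contDiffAt_mul_rpow k ht) (fun t ht => h.abs_mul_rpow_le hk ht)
    (fun t ht => h.abs_deriv_mul_rpow_le hk ht) hkn (contDiff_heightGrad Φ)
    (inner_heightGrad_self Φ) hbn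
  have hD : Integrable (fun x : Sph n => P (height Φ x) * (1 - height Φ x ^ 2) ^ (-k) *
      surfDiv (heightGrad Φ) x) (surf n) := by
    obtain ⟨D, hD⟩ := isCompact_univ.exists_bound_of_continuousOn
      (continuous_surfDiv (contDiff_heightGrad Φ)).continuousOn
    exact h0.mul_bdd (c := D)
      (continuous_surfDiv (contDiff_heightGrad Φ)).aestronglyMeasurable
      (ae_of_all _ fun x => hD x (Set.mem_univ x))
  rw [eq_neg_iff_add_eq_zero, ← integral_add h1 hD] at h2
  rw [← h2]
  refine integral_congr_ae ?_
  filter_upwards [ae_height_mem_Ioo hn Φ] with x hx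
  have hy := one_sub_sq_pos hx
  rw [h.deriv_mul_rpow k hx, inner_pole_heightGrad, surfDiv_heightGrad, Real.rpow_sub_one hy.ne',
    ← hkκ]
  field_simp
  ring

/-- The zonal function `P(c) (1 - c²) ^ (-k)` belongs to `W^{1,p}` when `(2k + 1) p < n - 1`. -/
theorem memW1pWithGradient (h : BoundedProfile P B) (hn : 2 ≤ n) (Φ : Sph n) {k p : ℝ}
    (hk : 0 ≤ k) (hp : 1 ≤ p) (hkp : (2 * k + 1) * p < (n : ℝ) - 1) :
    MemW1pWithGradient p (fun x : Sph n => P (height Φ x) * (1 - height Φ x ^ 2) ^ (-k))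
      (fun x : Sph n => deriv (fun t => P t * (1 - t ^ 2) ^ (-k)) (height Φ x) •
        heightGrad Φ x) := by
  set g : ℝ → ℝ := fun t => P t * (1 - t ^ 2) ^ (-k) with hg
  set C := (1 + 2 * k) * B with hC
  have hp0 : ENNReal.ofReal p ≠ 0 := by simp; linarith
  have hp1 : 1 ≤ ENNReal.ofReal p := by simpa using hp
  have hLp : ∀ q : ℝ, 2 * q * p < (n : ℝ) - 1 →
      MemLp (fun x : Sph n => (1 - height Φ x ^ 2) ^ (-q)) (ENNReal.ofReal p) (surf n) := by
    intro q hq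
    have hm : AEStronglyMeasurable (fun x : Sph n => (1 - height Φ x ^ 2) ^ (-q)) (surf n) :=
      ((measurable_const.sub ((continuous_height Φ).measurable.pow_const 2)).pow_const
        _).aestronglyMeasurable
    rw [← integrable_norm_rpow_iff hm hp0 ENNReal.ofReal_ne_top,
      ENNReal.toReal_ofReal (by linarith)]
    refine (integrable_one_sub_height_sq_rpow hn Φ (k := q * p) (by linarith)).congr
      (ae_of_all _ fun x => ?_)
    have hy := one_sub_height_sq_nonneg Φ x
    simp only
    rw [Real.norm_of_nonneg (Real.rpow_nonneg hy _), ← Real.rpow_mul hy, neg_mul]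
  have h1n : 2 * k + 1 < (n : ℝ) - 1 := by nlinarith
  have h0 := h.integrable_mul_rpow hn Φ (k := k) (by linarith)
  have hmg : AEStronglyMeasurable (fun x : Sph n => deriv g (height Φ x) • heightGrad Φ x)
      (surf n) :=
    ((measurable_deriv g).comp (continuous_height Φ).measurable).aestronglyMeasurable.smul
      ((contDiff_heightGrad Φ).continuous.comp continuous_subtype_val).aestronglyMeasurable
  have hgrad : MemLp (fun x : Sph n => deriv g (height Φ x) • heightGrad Φ x)
      (ENNReal.ofReal p) (surf n) := by
    -- The factor `‖∇c‖ = √(1 - c²)` gains half a power over the bound for the derivative; this is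
    -- the source of `2k + 1` in the hypothesis.
    refine (hLp (k + 1 / 2) (by linarith)).of_le_mul (c := C) hmg ?_
    filter_upwards [ae_height_mem_Ioo hn Φ] with x hx
    have hy := one_sub_sq_pos hx
    rw [norm_smul, norm_heightGrad, Real.norm_eq_abs,
      Real.norm_of_nonneg (Real.rpow_nonneg hy.le _)]
    calc _ ≤ C * (1 - height Φ x ^ 2) ^ (-(k + 1)) * √(1 - height Φ x ^ 2) := by
          gcongr; exact h.abs_deriv_mul_rpow_le hk hx
      _ = _ := by
          rw [Real.sqrt_eq_rpow, mul_assoc, ← Real.rpow_add hy]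
          congr 2; ring
  refine ⟨⟨h0, hgrad.integrable hp1, fun x => ?_, fun V hV ht => ?_⟩, ?_, hgrad⟩
  · rw [inner_smul_left, inner_heightGrad_self, mul_zero]
  · have hinner : ∀ x : Sph n, ⟪deriv g (height Φ x) • heightGrad Φ x, V x⟫ =
        deriv g (height Φ x) * ⟪(Φ : EuclideanSpace ℝ (Fin n)), V x⟫ := fun x => by
      rw [inner_smul_left, inner_heightGrad_of_tangential Φ x (ht x)]; rfl
    simp only [hinner]
    refine (integral_zonal_by_parts_of_bound hn Φ hk (by linarith : 0 ≤ k + 1)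
      (fun t ht => h.contDiffAt_mul_rpow k ht) (fun t ht => h.abs_mul_rpow_le hk ht)
      (fun t ht => h.abs_deriv_mul_rpow_le hk ht) (by linarith) hV ht ?_).2.2
    have hVc : Continuous fun x : Sph n => V x := hV.continuous.comp continuous_subtype_val
    obtain ⟨M, hM⟩ := isCompact_univ.exists_bound_of_continuousOn hVc.continuousOn
    -- A tangential test field pairs with the pole only through `∇c`, so `|⟪Φ, V⟫| ≤ M √(1 - c²)`.
    refine ((integrable_one_sub_height_sq_rpow hn Φ (k := k + 1 / 2)
      (by linarith)).mul_const M).mono' ?_ ?_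
    · refine AEStronglyMeasurable.mul ?_ (continuous_const.inner hVc).abs.aestronglyMeasurable
      exact ((measurable_const.sub ((continuous_height Φ).measurable.pow_const 2)).pow_const
        _).aestronglyMeasurable
    · filter_upwards [ae_height_mem_Ioo hn Φ] with x hx
      have hy := one_sub_sq_pos hx
      have hy1 := Real.rpow_pos_of_pos hy (-(k + 1))
      rw [norm_mul, Real.norm_of_nonneg hy1.le, Real.norm_eq_abs, abs_abs,
        ← inner_heightGrad_of_tangential Φ x (ht x)]
      calc _ ≤ (1 - height Φ x ^ 2) ^ (-(k + 1)) * (√(1 - height Φ x ^ 2) * M) := by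
            gcongr
            refine (abs_real_inner_le_norm _ _).trans ?_
            rw [norm_heightGrad]
            gcongr
            exact hM x (Set.mem_univ x)
        _ = _ := by
            rw [Real.sqrt_eq_rpow, ← mul_assoc, ← Real.rpow_add hy]
            congr 2; ring
  · refine (hLp k (by nlinarith)).of_le_mul (c := C) h0.aestronglyMeasurable ?_
    filter_upwards [ae_height_mem_Ioo hn Φ] with x hx
    rw [Real.norm_of_nonneg (Real.rpow_nonneg (one_sub_sq_pos hx).le (-k))]
    exact h.abs_mul_rpow_le hk hx

end BoundedProfile

/-! ### Exact relations between the weighted integrals -/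

/-- The profile `P(c) = c` gives the factor `(1 - c²) - κ c² = (1 + κ) (1 - c²) - κ` in the
divergence identity. -/
theorem integral_sq_mul_rpow (hn : 2 ≤ n) (Φ : Sph n) {k κ : ℝ}
    (hk : 0 ≤ k) (hκ : 0 < κ) (hkκ : 2 * k + κ = (n : ℝ) - 1) :
    (1 + κ) * ∫ x, (1 - height Φ x ^ 2) ^ (1 - k) ∂(surf n) =
      κ * ∫ x, (1 - height Φ x ^ 2) ^ (-k) ∂(surf n) := by
  have h := boundedProfile_id.integral_eq_zero hn Φ hk hκ hkκ
  have h1 := integrable_one_sub_height_sq_rpow hn Φ (k := k - 1) (by linarith)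
  have h2 := integrable_one_sub_height_sq_rpow hn Φ (k := k) (by linarith)
  rw [neg_sub] at h1
  rw [← sub_eq_zero, ← integral_const_mul, ← integral_const_mul,
    ← integral_sub (h1.const_mul _) (h2.const_mul _), ← h]
  refine integral_congr_ae ?_
  filter_upwards [ae_height_mem_Ioo hn Φ] with x hx
  have hy := one_sub_sq_pos hx
  rw [sub_eq_neg_add 1 k, Real.rpow_add_one hy.ne', deriv_id'']
  ring

/-- With `s = 1 + c`, the profile `s ^ b` gives `b (2 - s) - κ (s - 1) = (2b + κ) - (b + κ) s`, a
recursion from `b` to `b + 1`. It is used at `b = a` and `b = a + 1`, since `1 - c² = 2s - s²`. -/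
theorem integral_one_add_rpow_mul (hn : 2 ≤ n) (Φ : Sph n) {k κ a : ℝ}
    (ha : 0 < a) (hk : 0 ≤ k) (hκ : 0 < κ) (hkκ : 2 * k + κ = (n : ℝ) - 1) :
    (a + κ) * (a + κ + 1) *
        ∫ x, (1 + height Φ x) ^ a * (1 - height Φ x ^ 2) ^ (1 - k) ∂(surf n) =
      κ * (2 * a + κ) *
        ∫ x, (1 + height Φ x) ^ a * (1 - height Φ x ^ 2) ^ (-k) ∂(surf n) := by
  have hint : ∀ b : ℝ, 0 ≤ b → Integrable (fun x =>
      (1 + height Φ x) ^ b * (1 - height Φ x ^ 2) ^ (-k)) (surf n) := fun b hb =>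
    (boundedProfile_one_add_rpow hb).integrable_mul_rpow hn Φ (by linarith)
  have key : ∀ b : ℝ, 0 ≤ b →
      (2 * b) * ∫ x, (1 + height Φ x) ^ b * (1 - height Φ x ^ 2) ^ (-k) ∂(surf n) + κ *
        ∫ x, (1 + height Φ x) ^ b * (1 - height Φ x ^ 2) ^ (-k) ∂(surf n) =
      (b + κ) * ∫ x, (1 + height Φ x) ^ (b + 1) * (1 - height Φ x ^ 2) ^ (-k) ∂(surf n) := by
    intro b hb
    have h := (boundedProfile_one_add_rpow hb).integral_eq_zero hn Φ hk hκ hkκ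
    rw [← add_mul, ← sub_eq_zero, ← integral_const_mul, ← integral_const_mul,
      ← integral_sub ((hint b hb).const_mul _) ((hint (b + 1) (by linarith)).const_mul _), ← h]
    refine integral_congr_ae ?_
    filter_upwards [ae_height_mem_Ioo hn Φ] with x hx
    have h1 : 1 + height Φ x ≠ 0 := by linarith [hx.1]
    rw [deriv_one_add_rpow_mul hx.1, Real.rpow_add_one h1]
    ring
  have k1 := key a ha.le
  have k2 := key (a + 1) (by linarith)
  have h3 : ∫ x, (1 + height Φ x) ^ a * (1 - height Φ x ^ 2) ^ (1 - k) ∂(surf n) =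
      2 * ∫ x, (1 + height Φ x) ^ (a + 1) * (1 - height Φ x ^ 2) ^ (-k) ∂(surf n) -
      ∫ x, (1 + height Φ x) ^ (a + 1 + 1) * (1 - height Φ x ^ 2) ^ (-k) ∂(surf n) := by
    rw [← integral_const_mul, ← integral_sub ((hint _ (by linarith)).const_mul _)
      (hint _ (by linarith))]
    refine integral_congr_ae ?_
    filter_upwards [ae_height_mem_Ioo hn Φ] with x hx
    have hy := one_sub_sq_pos hx
    have h1 : 1 + height Φ x ≠ 0 := by linarith [hx.1]
    rw [sub_eq_neg_add 1 k, Real.rpow_add_one hy.ne', Real.rpow_add_one h1 (a + 1),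
      Real.rpow_add_one h1 a]
    ring
  rw [h3]
  set A := ∫ x, (1 + height Φ x) ^ a * (1 - height Φ x ^ 2) ^ (-k) ∂(surf n)
  set A1 := ∫ x, (1 + height Φ x) ^ (a + 1) * (1 - height Φ x ^ 2) ^ (-k) ∂(surf n)
  set A2 := ∫ x, (1 + height Φ x) ^ (a + 1 + 1) * (1 - height Φ x ^ 2) ^ (-k) ∂(surf n)
  linear_combination (a + κ) * k2 - κ * k1

theorem integral_pos_of_ae_pos (hn : 2 ≤ n) {f : Sph n → ℝ} (hf : Integrable f (surf n))
    (hpos : ∀ᵐ x ∂(surf n), 0 < f x) : 0 < ∫ x, f x ∂(surf n) := by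
  have : Nontrivial (EuclideanSpace ℝ (Fin n)) := by
    have : Nonempty (Fin n) := ⟨⟨0, by omega⟩⟩
    infer_instance
  rw [integral_pos_iff_support_of_nonneg_ae (hpos.mono fun _ h => h.le) hf]
  have h : Function.support f =ᵐ[surf n] Set.univ := by
    rw [eventuallyEq_univ]
    filter_upwards [hpos] with x hx using hx.ne'
  rw [measure_congr h, pos_iff_ne_zero, Ne, Measure.measure_univ_eq_zero]
  exact Measure.toSphere_ne_zero _

/-! ### Evaluation of the functionals -/

/-- The tangent line at `x` lies below the convex function `t ^ p`; this is Bernoulli's inequality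
for `y / x`. -/
theorem rpow_sub_le_rpow_sub_rpow {p x y : ℝ} (hp : 1 ≤ p) (hx : 0 < x) (hxy : x ≤ y) :
    p * x ^ (p - 1) * (y - x) ≤ y ^ p - x ^ p := by
  have h := one_add_mul_self_le_rpow_one_add (s := y / x - 1)
    (by linarith [div_nonneg (hx.le.trans hxy) hx.le]) hp
  rw [add_sub_cancel, Real.div_rpow (hx.le.trans hxy) hx.le, le_div_iff₀ (by positivity)] at h
  have hxp : x ^ p = x ^ (p - 1) * x := by
    rw [← Real.rpow_add_one hx.ne', sub_add_cancel]
  have h2 : (1 + p * (y / x - 1)) * x ^ p = x ^ p + p * x ^ (p - 1) * (y - x) := by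
    rw [hxp]; field_simp
  linarith

/-- `|c|^p ≤ |c| ≤ (1 + c²) / 2`. The deficit `(1 - c²) / 2` is what makes the violation in (a)
strict. -/
theorem rpow_abs_le_one_sub {p c : ℝ} (hp : 1 ≤ p) (hc : |c| ≤ 1) :
    |c| ^ p ≤ 1 - (1 - c ^ 2) / 2 := by
  rcases eq_or_lt_of_le (abs_nonneg c) with h | h
  · rw [← h, Real.zero_rpow (by linarith)]
    nlinarith [sq_abs c]
  · have : |c| ^ p ≤ |c| := by
      simpa using Real.rpow_le_rpow_of_exponent_ge h hc hp
    nlinarith [sq_abs c]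

theorem sin_geoDist_rpow (Φ x : Sph n) (q : ℝ) :
    Real.sin (geoDist Φ x) ^ q = (1 - height Φ x ^ 2) ^ (q / 2) := by
  rw [sin_geoDist, Real.sqrt_eq_rpow, ← Real.rpow_mul (one_sub_height_sq_nonneg Φ x)]
  congr 1; ring

/-- The weighted integrand of `Q(c) (1 - c²) ^ (-k)` at a point off the poles. -/
theorem weighted_mul_rpow (Φ : Sph n) {x : Sph n} (hx : height Φ x ∈ Set.Ioo (-1 : ℝ) 1)
    (p q k Q : ℝ) {u : Sph n → ℝ} (hu : u x = Q * (1 - height Φ x ^ 2) ^ (-k)) :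
    weighted Φ p q u x = |Q| ^ p * (1 - height Φ x ^ 2) ^ (-(k * p + q / 2)) := by
  have hy := one_sub_sq_pos hx
  have hyk := Real.rpow_pos_of_pos hy (-k)
  rw [weighted, hu, sin_geoDist_rpow, abs_mul, abs_of_pos hyk,
    Real.mul_rpow (abs_nonneg _) hyk.le, ← Real.rpow_mul hy.le, mul_div_assoc,
    ← Real.rpow_sub hy]
  congr 2; ring

theorem norm_smul_heightGrad_rpow (Φ : Sph n) {x : Sph n}
    (hx : height Φ x ∈ Set.Ioo (-1 : ℝ) 1) (p k Q : ℝ) :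
    ‖(Q * (1 - height Φ x ^ 2) ^ (-k - 1)) • heightGrad Φ x‖ ^ p =
      |Q| ^ p * (1 - height Φ x ^ 2) ^ (-(k * p + p / 2)) := by
  have hy := one_sub_sq_pos hx
  have hyk := Real.rpow_pos_of_pos hy (-k - 1)
  rw [norm_smul, norm_heightGrad, Real.norm_eq_abs, abs_mul, abs_of_pos hyk, mul_assoc,
    Real.sqrt_eq_rpow, ← Real.rpow_add hy, Real.mul_rpow (abs_nonneg _) (by positivity),
    ← Real.rpow_mul hy.le]
  congr 2; ring

/-- The powers `(sin d) ^ (-γ)` violate the inequality when `γ` is close to `α`. -/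
theorem isCounterexample_sin_rpow (hn : 2 ≤ n) (Φ : Sph n) {p κ : ℝ} (hp : 1 < p)
    (hκ : 0 < κ) (hκp : κ < (n : ℝ) - p - 1)
    (hineq : alpha n p ^ (p - 1) <
      (alpha n p - κ / p) ^ (p - 1) * (1 + κ) + (alpha n p - κ / p) ^ p / 2) :
    IsCounterexample Φ p
      (fun x => 1 * (1 - height Φ x ^ 2) ^ (-((alpha n p - κ / p) / 2))) := by
  have hp0 : 0 < p := by linarith
  set α := alpha n p with hα
  have hαp : α * p = (n : ℝ) - p - 1 := by rw [hα, alpha]; field_simp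
  set γ := α - κ / p with hγ
  have hγp : γ * p = (n : ℝ) - p - 1 - κ := by rw [hγ, sub_mul, hαp]; field_simp
  have hγ0 : 0 < γ := by
    by_contra h
    nlinarith
  -- The exponent for which `(1 - c²)^(-k)` is the integrand of `S_p(u)`; its distance from
  -- criticality is `κ`.
  set k := γ / 2 * p + p / 2 with hk
  have hk0 : 0 ≤ k := by positivity
  have hkκ : 2 * k + κ = (n : ℝ) - 1 := by rw [hk]; linarith
  set u : Sph n → ℝ := fun x => 1 * (1 - height Φ x ^ 2) ^ (-(γ / 2)) with hu
  have hS : ∀ᵐ x ∂(surf n), weighted Φ p p u x = (1 - height Φ x ^ 2) ^ (-k) := by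
    filter_upwards [ae_height_mem_Ioo hn Φ] with x hx
    rw [weighted_mul_rpow Φ hx p p (γ / 2) 1 rfl, abs_one, Real.one_rpow, one_mul]
  have hT : ∀ᵐ x ∂(surf n), weighted Φ p (p - 2) u x = (1 - height Φ x ^ 2) ^ (1 - k) := by
    filter_upwards [ae_height_mem_Ioo hn Φ] with x hx
    rw [weighted_mul_rpow Φ hx p (p - 2) (γ / 2) 1 rfl, abs_one, Real.one_rpow, one_mul]
    congr 1; rw [hk]; ring
  have hiS := integrable_one_sub_height_sq_rpow hn Φ (k := k) (by linarith)
  have hiT := integrable_one_sub_height_sq_rpow hn Φ (k := k - 1) (by linarith)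
  rw [neg_sub] at hiT
  refine ⟨_, boundedProfile_one.memW1pWithGradient hn Φ (k := γ / 2) (by positivity) hp.le
    (by linarith), hiS.congr (hS.mono fun x h => h.symm), hiT.congr (hT.mono fun x h => h.symm),
    ?_⟩
  rw [S, STilde, integral_congr_ae hS, integral_congr_ae hT]
  have hF : F p (fun x : Sph n => deriv (fun t : ℝ => 1 * (1 - t ^ 2) ^ (-(γ / 2))) (height Φ x) •
      heightGrad Φ x) ≤ γ ^ p * (∫ x, (1 - height Φ x ^ 2) ^ (-k) ∂(surf n) -
        (∫ x, (1 - height Φ x ^ 2) ^ (1 - k) ∂(surf n)) / 2) := by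
    rw [F, ← integral_div, ← integral_sub hiS (hiT.div_const 2), ← integral_const_mul]
    refine integral_mono_of_nonneg (ae_of_all _ fun x => by positivity)
      ((hiS.sub (hiT.div_const 2)).const_mul _) ?_
    filter_upwards [ae_height_mem_Ioo hn Φ] with x hx
    have hy := one_sub_sq_pos hx
    have h1 := rpow_abs_le_one_sub hp.le (abs_height_le Φ x)
    have h2 := Real.rpow_pos_of_pos hy (-k)
    rw [boundedProfile_one.deriv_mul_rpow (γ / 2) hx, norm_smul_heightGrad_rpow Φ hx, ← hk,
      sub_eq_neg_add 1 k, Real.rpow_add_one hy.ne', deriv_const, zero_mul, zero_add, mul_one,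
      mul_div_cancel₀ γ two_ne_zero, abs_mul, abs_of_pos hγ0, Real.mul_rpow hγ0.le (abs_nonneg _)]
    calc γ ^ p * |height Φ x| ^ p * (1 - height Φ x ^ 2) ^ (-k)
        ≤ γ ^ p * (1 - (1 - height Φ x ^ 2) / 2) * (1 - height Φ x ^ 2) ^ (-k) := by gcongr
      _ = _ := by ring
  have hrel := integral_sq_mul_rpow hn Φ hk0 hκ hkκ
  have hTpos := integral_pos_of_ae_pos hn hiT (by
    filter_upwards [ae_height_mem_Ioo hn Φ] with x hx
    exact Real.rpow_pos_of_pos (one_sub_sq_pos hx) _)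
  set IS := ∫ x, (1 - height Φ x ^ 2) ^ (-k) ∂(surf n)
  set IT := ∫ x, (1 - height Φ x ^ 2) ^ (1 - k) ∂(surf n)
  have hISpos : 0 < IS := by
    have : 0 < κ * IS := by rw [← hrel]; positivity
    exact pos_of_mul_pos_right this hκ.le
  have hconv := rpow_sub_le_rpow_sub_rpow hp.le hγ0 (y := α) (by
    rw [hγ]; linarith [div_pos hκ hp0])
  have hd : p * γ ^ (p - 1) * (α - γ) = γ ^ (p - 1) * κ := by rw [hγ]; field_simp; ring
  rw [hd] at hconv
  have e1 := mul_le_mul_of_nonneg_right hconv hISpos.le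
  have e2 := mul_lt_mul_of_pos_right hineq hTpos
  -- The gain is `κ` times an integral of size `1/κ`; the exact relation rewrites it as a multiple
  -- of `S̃`.
  have e3 : γ ^ (p - 1) * κ * IS = γ ^ (p - 1) * (1 + κ) * IT := by
    rw [mul_assoc, ← hrel]; ring
  show _ < _
  linarith

/-- At `κ = 0` the criterion reads `α^(p-1) < α^(p-1) + α^p / 2`, so by continuity it persists for
small `κ > 0`. -/
theorem exists_isCounterexample (hn : 2 ≤ n) (Φ : Sph n) {p : ℝ} (hp : 1 < p)
    (hpn : p < (n : ℝ) - 1) : ∃ u : Sph n → ℝ, IsCounterexample Φ p u := by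
  have hα : 0 < alpha n p := div_pos (by linarith) (by linarith)
  have hc : ∀ q : ℝ, ContinuousAt (fun κ : ℝ => (alpha n p - κ / p) ^ q) 0 := fun q =>
    (continuousAt_const.sub (continuousAt_id.div_const p)).rpow_const
      (Or.inl (by simpa using hα.ne'))
  have h1 : ∀ᶠ κ : ℝ in 𝓝 0, alpha n p ^ (p - 1) <
      (alpha n p - κ / p) ^ (p - 1) * (1 + κ) + (alpha n p - κ / p) ^ p / 2 := by
    refine continuousAt_const.eventually_lt (((hc _).mul (continuousAt_const.add continuousAt_id)).add
      ((hc p).div_const 2)) ?_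
    have := Real.rpow_pos_of_pos hα p
    simp
    exact this
  have h2 : ∀ᶠ κ : ℝ in 𝓝 0, κ < (n : ℝ) - p - 1 := eventually_lt_nhds (by linarith)
  obtain ⟨κ, ⟨hκ1, hκ2⟩, hκ0⟩ := (((h1.and h2).filter_mono nhdsWithin_le_nhds).and
    (self_mem_nhdsWithin (s := Set.Ioi (0 : ℝ)))).exists
  exact ⟨_, isCounterexample_sin_rpow hn Φ hp hκ0 hκ2 hκ1⟩

/-! ### The explicit family `w_ε` -/

theorem w_eq (Φ : Sph n) (p ε : ℝ) (x : Sph n) :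
    w Φ p ε x = (1 + height Φ x) ^ (((n : ℝ) - p - 1 - 2 * ε) / p) *
      (1 - height Φ x ^ 2) ^ (-(((n : ℝ) - p - 1 - 2 * ε) / p / 2)) := by
  rw [w, Real.div_rpow (by rw [cos_geoDist]; linarith [(height_mem_Icc Φ x).1])
    (by rw [sin_geoDist]; positivity), sin_geoDist_rpow, cos_geoDist, div_eq_mul_inv,
    Real.rpow_neg (one_sub_height_sq_nonneg Φ x)]

/-- The functions `w_ε` violate the inequality when the exponent is close to `α`. -/
theorem isCounterexample_w (hn : 2 ≤ n) (Φ : Sph n) {p ε : ℝ} (hp : 1 < p)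
    (hε : 0 < ε) (hεp : 2 * ε < (n : ℝ) - p - 1)
    (hineq : alpha n p ^ (p - 1) * 2 <
      (alpha n p - 2 * ε / p) ^ (p - 1) * ((n : ℝ) - p)) :
    IsCounterexample Φ p (w Φ p ε) := by
  have hp0 : 0 < p := by linarith
  set β := ((n : ℝ) - p - 1 - 2 * ε) / p with hβ
  have hβ0 : 0 < β := div_pos (by linarith) hp0
  have hβp : β * p = (n : ℝ) - p - 1 - 2 * ε := by rw [hβ]; field_simp
  have hαβ : alpha n p - 2 * ε / p = β := by rw [hβ, alpha]; ring
  rw [hαβ] at hineq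
  set α := alpha n p with hα
  have hα0 : 0 < α := by rw [hα, alpha]; exact div_pos (by linarith) hp0
  set a := β * p with ha
  have ha0 : 0 < a := by positivity
  set k := β / 2 * p + p / 2 with hk
  have hk0 : 0 ≤ k := by positivity
  have hkκ : 2 * k + 2 * ε = (n : ℝ) - 1 := by rw [hk]; linarith
  have hw : w Φ p ε = fun x => (1 + height Φ x) ^ β * (1 - height Φ x ^ 2) ^ (-(β / 2)) :=
    funext fun x => w_eq Φ p ε x
  have hQ : ∀ x : Sph n, |(1 + height Φ x) ^ β| ^ p = (1 + height Φ x) ^ a := fun x => by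
    have : 0 ≤ 1 + height Φ x := by linarith [(height_mem_Icc Φ x).1]
    rw [abs_of_nonneg (Real.rpow_nonneg this _), ← Real.rpow_mul this]
  rw [hw]
  set u : Sph n → ℝ := fun x => (1 + height Φ x) ^ β * (1 - height Φ x ^ 2) ^ (-(β / 2)) with hu
  have hS : ∀ᵐ x ∂(surf n), weighted Φ p p u x =
      (1 + height Φ x) ^ a * (1 - height Φ x ^ 2) ^ (-k) := by
    filter_upwards [ae_height_mem_Ioo hn Φ] with x hx
    rw [weighted_mul_rpow Φ hx p p (β / 2) _ rfl, hQ]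
  have hT : ∀ᵐ x ∂(surf n), weighted Φ p (p - 2) u x =
      (1 + height Φ x) ^ a * (1 - height Φ x ^ 2) ^ (1 - k) := by
    filter_upwards [ae_height_mem_Ioo hn Φ] with x hx
    rw [weighted_mul_rpow Φ hx p (p - 2) (β / 2) _ rfl, hQ]
    congr 2; rw [hk]; ring
  have hiS := (boundedProfile_one_add_rpow ha0.le).integrable_mul_rpow hn Φ (k := k) (by linarith)
  have hiT := (boundedProfile_one_add_rpow ha0.le).integrable_mul_rpow hn Φ (k := k - 1)
    (by linarith)
  rw [neg_sub] at hiT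
  refine ⟨_, (boundedProfile_one_add_rpow hβ0.le).memW1pWithGradient hn Φ (k := β / 2)
    (by positivity) hp.le (by linarith), hiS.congr (hS.mono fun x h => h.symm),
    hiT.congr (hT.mono fun x h => h.symm), ?_⟩
  rw [S, STilde, integral_congr_ae hS, integral_congr_ae hT]
  have hF : F p (fun x : Sph n => deriv (fun t : ℝ => (1 + t) ^ β * (1 - t ^ 2) ^ (-(β / 2)))
      (height Φ x) • heightGrad Φ x) =
      β ^ p * ∫ x, (1 + height Φ x) ^ a * (1 - height Φ x ^ 2) ^ (-k) ∂(surf n) := by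
    rw [F, ← integral_const_mul]
    refine integral_congr_ae ?_
    filter_upwards [ae_height_mem_Ioo hn Φ] with x hx
    -- The terms in `c` cancel, since `log cot (d/2)` has derivative `-1 / sin d`; hence `F` is
    -- exactly a multiple of `S`.
    have h1 : deriv (fun t : ℝ => (1 + t) ^ β) (height Φ x) * (1 - height Φ x ^ 2) +
        2 * (β / 2) * height Φ x * (1 + height Φ x) ^ β = β * (1 + height Φ x) ^ β := by
      rw [deriv_one_add_rpow_mul hx.1]; ring
    rw [(boundedProfile_one_add_rpow hβ0.le).deriv_mul_rpow (β / 2) hx,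
      norm_smul_heightGrad_rpow Φ hx, h1, abs_mul, Real.mul_rpow (abs_nonneg _) (abs_nonneg _), hQ,
      abs_of_pos hβ0, ← hk]
    ring
  rw [hF]
  have hrel := integral_one_add_rpow_mul hn Φ ha0 hk0 (by linarith : 0 < 2 * ε) hkκ
  have hSpos := integral_pos_of_ae_pos hn hiS (by
    filter_upwards [ae_height_mem_Ioo hn Φ] with x hx
    exact mul_pos (Real.rpow_pos_of_pos (by linarith [hx.1]) _)
      (Real.rpow_pos_of_pos (one_sub_sq_pos hx) _))
  set IS := ∫ x, (1 + height Φ x) ^ a * (1 - height Φ x ^ 2) ^ (-k) ∂(surf n)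
  set IT := ∫ x, (1 + height Φ x) ^ a * (1 - height Φ x ^ 2) ^ (1 - k) ∂(surf n)
  have hconv := rpow_sub_le_rpow_sub_rpow hp.le hβ0 (y := α) (by
    rw [← hαβ]; linarith [div_pos (mul_pos two_pos hε) hp0])
  have hd : p * β ^ (p - 1) * (α - β) = β ^ (p - 1) * (2 * ε) := by
    rw [← hαβ]; field_simp; ring
  rw [hd] at hconv
  set m := (n : ℝ) - p - 1 with hm
  have hm0 : 0 < m := by linarith
  have ham : a + 2 * ε = m := by rw [hβp]; ring
  have hnp : (n : ℝ) - p = m + 1 := by rw [hm]; ring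
  rw [ham] at hrel
  rw [hnp] at hineq
  have hIT : IT = 2 * ε * (2 * a + 2 * ε) / (m * (m + 1)) * IS := by
    field_simp
    linarith
  -- Here `2a + 2ε ≤ 2m`, because `a + 2ε = m`.
  have hITle : IT ≤ 2 * ε * (2 / (m + 1)) * IS := by
    rw [hIT]
    refine mul_le_mul_of_nonneg_right ?_ hSpos.le
    rw [mul_div_assoc]
    refine mul_le_mul_of_nonneg_left ?_ (by linarith)
    rw [div_le_div_iff₀ (by positivity) (by positivity)]
    nlinarith
  have hαp := Real.rpow_pos_of_pos hα0 (p - 1)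
  have h1 : α ^ (p - 1) * (2 / (m + 1)) < β ^ (p - 1) := by
    rw [← mul_div_assoc, div_lt_iff₀ (by linarith)]
    exact hineq
  have h2 : α ^ (p - 1) * IT < β ^ (p - 1) * (2 * ε) * IS :=
    calc _ ≤ α ^ (p - 1) * (2 * ε * (2 / (m + 1)) * IS) := by gcongr
      _ = α ^ (p - 1) * (2 / (m + 1)) * (2 * ε * IS) := by ring
      _ < β ^ (p - 1) * (2 * ε * IS) := by gcongr
      _ = _ := by ring
  have h3 := mul_le_mul_of_nonneg_right hconv hSpos.le
  show _ < _
  linarith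

/-- At `ε = 0` the criterion reduces to `2 < n - p`, which is where `p < n - 2` enters. -/
theorem exists_forall_isCounterexample_w (hn : 2 ≤ n) (Φ : Sph n) {p : ℝ} (hp : 1 < p)
    (hpn : p < (n : ℝ) - 2) :
    ∃ ε₀ : ℝ, 0 < ε₀ ∧ ε₀ < ((n : ℝ) - p - 1) / 2 ∧
      ∀ ε : ℝ, 0 < ε → ε < ε₀ → IsCounterexample Φ p (w Φ p ε) := by
  have hα : 0 < alpha n p := div_pos (by linarith) (by linarith)
  have h1 : ∀ᶠ ε : ℝ in 𝓝 0, alpha n p ^ (p - 1) * 2 <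
      (alpha n p - 2 * ε / p) ^ (p - 1) * ((n : ℝ) - p) := by
    refine continuousAt_const.eventually_lt (ContinuousAt.mul
      (((continuousAt_const.sub ((continuousAt_const.mul continuousAt_id).div_const p)).rpow_const
      (Or.inl (by simpa using hα.ne')))) continuousAt_const) ?_
    have := Real.rpow_pos_of_pos hα (p - 1)
    simp only [mul_zero, zero_div, sub_zero]
    nlinarith
  obtain ⟨δ, hδ, h⟩ := Metric.eventually_nhds_iff.1 h1
  -- A quarter, not a half, of `n - p - 1` makes the upper bound on `ε₀` strict.
  refine ⟨min δ (((n : ℝ) - p - 1) / 4), lt_min hδ (by linarith),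
    (min_le_right _ _).trans_lt (by linarith), fun ε hε hεlt => ?_⟩
  have hε1 := hεlt.trans_le (min_le_left _ _)
  have hε2 := hεlt.trans_le (min_le_right _ _)
  exact isCounterexample_w hn Φ hp hε (by linarith)
    (h (by rwa [Real.dist_eq, sub_zero, abs_of_pos hε]))

/-! ### The case `p = 2` and the three statements -/

theorem weighted_two_two (Φ : Sph n) (u : Sph n → ℝ) :
    weighted Φ 2 2 u = fun x => u x ^ 2 / Real.sin (geoDist Φ x) ^ 2 := by
  ext x
  simp [weighted]

theorem weighted_two_zero (Φ : Sph n) (u : Sph n → ℝ) :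
    weighted Φ 2 (2 - 2) u = fun x => u x ^ 2 := by
  ext x
  simp [weighted]

end SphereHardy

end

theorem mainTheorem4 (n : ℕ) (hn : 4 ≤ n) (Φ : SphereHardy.Sph n) :
    (∀ p : ℝ, 1 < p → p < (n : ℝ) - 1 →
      ∃ u : SphereHardy.Sph n → ℝ, SphereHardy.IsCounterexample Φ p u) ∧
    (4 < n →
      ∃ (u : SphereHardy.Sph n → ℝ) (Ψ : SphereHardy.Sph n → EuclideanSpace ℝ (Fin n)),
        SphereHardy.MemW1pWithGradient 2 u Ψ ∧
        Integrable (fun x => u x ^ 2 / Real.sin (SphereHardy.geoDist Φ x) ^ 2)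
          (SphereHardy.surf n) ∧
        (((n : ℝ) - 3) / 2) ^ 2 *
            ∫ x, u x ^ 2 / Real.sin (SphereHardy.geoDist Φ x) ^ 2 ∂(SphereHardy.surf n) >
          (∫ x, ‖Ψ x‖ ^ 2 ∂(SphereHardy.surf n)) +
            ((n : ℝ) - 3) / 2 * ∫ x, u x ^ 2 ∂(SphereHardy.surf n)) ∧
    (∀ p : ℝ, 1 < p → p < (n : ℝ) - 2 →
      ∃ ε₀ : ℝ, 0 < ε₀ ∧ ε₀ < ((n : ℝ) - p - 1) / 2 ∧
        ∀ ε : ℝ, 0 < ε → ε < ε₀ →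
          SphereHardy.IsCounterexample Φ p (SphereHardy.w Φ p ε)) := by
  have hn2 : 2 ≤ n := by omega
  refine ⟨fun p hp hpn => SphereHardy.exists_isCounterexample hn2 Φ hp hpn, fun _ => ?_,
    fun p hp hpn => SphereHardy.exists_forall_isCounterexample_w hn2 Φ hp hpn⟩
  have hn' : (4 : ℝ) ≤ n := by exact_mod_cast hn
  -- Part (b) is (a) at `p = 2`: the weight in `S̃` has exponent `p - 2 = 0`, and `α = (n - 3) / 2`.
  obtain ⟨u, Ψ, hm, hS, -, hlt⟩ :=
    SphereHardy.exists_isCounterexample hn2 Φ (p := 2) one_lt_two (by linarith)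
  have hα : SphereHardy.alpha n 2 = ((n : ℝ) - 3) / 2 := by rw [SphereHardy.alpha]; ring
  rw [SphereHardy.S, SphereHardy.STilde, SphereHardy.F, SphereHardy.weighted_two_two,
    SphereHardy.weighted_two_zero, hα] at hlt
  rw [SphereHardy.weighted_two_two] at hS
  refine ⟨u, Ψ, hm, hS, ?_⟩
  have h1 : (2 : ℝ) - 1 = 1 := by norm_num
  simpa only [Real.rpow_two, h1, Real.rpow_one] using hlt
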